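/- All graphs are finite and simple, and "$G$ contains $H$" means that $G$ has a subgraph (not necessarily induced) isomorphic to $H$. Write $K_m$ for the complete graph on $m$ vertices, $C_m$ for the cycle on $m$ vertices and $P_m$ for the path on $m+1$ vertices ($m$ edges); $K_3\cup P_3$ is a disjoint union. If $H$ is a graph on at most $m$ vertices, $K_m-H$ denotes the graph obtained from $K_m$ by removing the edges of a copy of $H$. Put $Z_4=K_4-P_2$. A non-increasing sequence $\pi=(d_1,\dots,d_n)$ of nonnegative integers is graphic if it is the degree sequence of a graph on $n$ vertices; any such graph is a realization of $\pi$. A graphic sequence is potentially $H$-graphic if some realization of it contains $H$. Let $\sigma(H,n)$ be the least even integer $l$ such that every $n$-term graphic sequence $\pi$ with $d_1+\dots+d_n\ge l$ is potentially $H$-graphic. Theorem 1.2. Let $n\ge 5r+18$, $r+1\ge k\ge 7$ and $j\ge 6$, and let $U$ be a graph on $k$ vertices with $j$ edges that contains $K_3\cup P_3$ but contains neither $C_4$ nor $Z_4$. Then $$\sigma(K_{r+1}-U,n)=\begin{cases}(r-1)(2n-r)-3(n-r)-1, & \text{if } n-r \text{ is odd},\\ (r-1)(2n-r)-3(n-r),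 & \text{if } n-r\text{ is even}.\end{cases}$$ -/

import Mathlib

open scoped SimpleGraph

/-- `K_m - H`: the complete graph on `W` with the edges of a copy of `H`, placed on the
vertices `f v` of `W`, removed. -/
def completeMinus {V W : Type*} (H : SimpleGraph V) (f : V ↪ W) : SimpleGraph W :=
  (H.map f)ᶜ

/-- `G` is a realization of the `n`-term sequence `d`: the vertex `i` has degree `d i`. -/
def IsRealization {n : ℕ} (G : SimpleGraph (Fin n)) (d : Fin n → ℕ) : Prop :=
  ∀ i, (G.neighborSet i).ncard = d i

/-- A non-increasing sequence of `n` nonnegative integers is graphic (lies in `GS_n`) if it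
is the degree sequence of a simple graph on `n` vertices. -/
def IsGraphic {n : ℕ} (d : Fin n → ℕ) : Prop :=
  Antitone d ∧ ∃ G : SimpleGraph (Fin n), IsRealization G d

/-- The sequence `d` has a realization containing `H` as a (not necessarily induced)
subgraph. -/
def PotentiallyGraphic {V : Type*} {n : ℕ} (H : SimpleGraph V) (d : Fin n → ℕ) : Prop :=
  ∃ G : SimpleGraph (Fin n), IsRealization G d ∧ H ⊑ G

/-- The even integers `l` such that every `n`-term graphic sequence with sum at least `l`
is potentially `H`-graphic. -/
def sigmaSet {V : Type*} (H : SimpleGraph V) (n : ℕ) : Set ℕ :=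
  {l | Even l ∧ ∀ d : Fin n → ℕ, IsGraphic d → l ≤ ∑ i, d i → PotentiallyGraphic H d}

/-- `σ(H, n)`: the least even integer `l` such that every `n`-term graphic sequence with sum
at least `l` is potentially `H`-graphic. -/
noncomputable def sigma {V : Type*} (H : SimpleGraph V) (n : ℕ) : ℕ :=
  sInf (sigmaSet H n)

/-- `K_3 ∪ P_3`, the disjoint union of a triangle and a path with 3 edges (4 vertices). -/
def K3unionP3 : SimpleGraph (Fin 3 ⊕ Fin 4) :=
  (⊤ : SimpleGraph (Fin 3)) ⊕g SimpleGraph.pathGraph 4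

/-- `Z_4 = K_4 - P_2`, where `P_2` is the path with 2 edges (3 vertices). -/
def Z4 : SimpleGraph (Fin 4) :=
  completeMinus (SimpleGraph.pathGraph 3) (Fin.castLEEmb (by norm_num))

open scoped Finset

/-!
*Lower bound.* The extremal sequence has all its realizations of the following form: `r - 3`
universal vertices, and outside them a matching, possibly with one path of two edges. Among `r + 1`
vertices, four are not universal and span at most two edges, so the complement of the graph they
induce contains `C_4` or `Z_4`. A copy of `K_{r+1} - U` would therefore put `C_4` or `Z_4` into `U`.

*Upper bound.* It suffices to find a realization which becomes complete on `r + 1` vertices once a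
copy of `K_3 ∪ P_3` is added to it; this is proved by induction on `r`. By switching, a vertex `u`
of maximal degree `Δ` can be made adjacent to all other vertices of degree at least that of the
`r`-th vertex in the degree order, provided that there are at most `Δ` of these. In that case `u` is
removed, a near clique is found in the rest and switched to its vertices of largest degree, all
adjacent to `u`, and `u` is put back. Otherwise the degree sequence is constant from place `r` to
place `Δ + 1`, and a realization is built by hand: the edges missing among the first `r + 1`
vertices are prescribed, these vertices are joined to the others so that the remaining demands stay
balanced, and the remaining demands are almost flat, hence graphic.
-/

section Degree

variable {V : Type*}

/-- The degree of a vertex, defined as in `IsRealization` so that it depends on no decidability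
instance. -/
noncomputable def deg (G : SimpleGraph V) (v : V) : ℕ := (G.neighborSet v).ncard

theorem deg_comap_equiv {W : Type*} (e : V ≃ W) (G : SimpleGraph W) (v : V) :
    deg (G.comap e) v = deg G (e v) :=
  Set.ncard_preimage_of_injective_subset_range e.injective (e.range_eq_univ ▸ Set.subset_univ _)

theorem deg_map {W : Type*} (p : V ↪ W) (G : SimpleGraph V) (v : V) :
    deg (G.map p) (p v) = deg G v := by
  rw [deg, deg, ← Set.ncard_image_of_injective _ p.injective]
  congr 1
  ext w
  simp

theorem deg_map_of_notMem_range {W : Type*} {p : V ↪ W} (G : SimpleGraph V) {w : W}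
    (hw : w ∉ Set.range p) : deg (G.map p) w = 0 := by
  have h : (G.map p).neighborSet w = ∅ := by
    ext u
    simp only [SimpleGraph.mem_neighborSet, SimpleGraph.map_adj, Set.mem_empty_iff_false, iff_false]
    rintro ⟨a, b, -, rfl, -⟩
    exact hw ⟨a, rfl⟩
  rw [deg, h, Set.ncard_empty]

theorem deg_eq_zero_iff [Finite V] {G : SimpleGraph V} {v : V} :
    deg G v = 0 ↔ ∀ w, ¬ G.Adj v w := by
  rw [deg, Set.ncard_eq_zero, Set.eq_empty_iff_forall_notMem]
  rfl

theorem deg_sup [Finite V] {G H : SimpleGraph V} (h : Disjoint G H) (v : V) :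
    deg (G ⊔ H) v = deg G v + deg H v :=
  Set.ncard_union_eq (SimpleGraph.disjoint_neighborSet.2 h v)

theorem deg_sdiff_add [Finite V] {G H : SimpleGraph V} (h : H ≤ G) (v : V) :
    deg (G \ H) v + deg H v = deg G v := by
  rw [← deg_sup disjoint_sdiff_self_left, sdiff_sup_cancel h]

variable [Fintype V]

theorem deg_eq_card (G : SimpleGraph V) [DecidableRel G.Adj] (v : V) :
    deg G v = #{w | G.Adj v w} := by
  rw [deg, ← Set.ncard_coe_finset, Finset.coe_filter_univ]
  rfl

theorem deg_lt_card (G : SimpleGraph V) (v : V) : deg G v < Fintype.card V := by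
  classical
  rw [deg_eq_card, ← Finset.card_univ]
  exact Finset.card_lt_card (Finset.filter_ssubset.2 ⟨v, Finset.mem_univ v, G.irrefl⟩)

theorem sum_deg (G : SimpleGraph V) : ∑ v, deg G v = 2 * G.edgeSet.ncard := by
  classical
  have h : ∀ v, deg G v = G.degree v := fun v => Set.ncard_eq_toFinset_card' _
  simp only [h, G.sum_degrees_eq_twice_card_edges, ← SimpleGraph.coe_edgeFinset,
    Set.ncard_coe_finset]

theorem even_sum_deg (G : SimpleGraph V) : Even (∑ v, deg G v) :=
  sum_deg G ▸ even_two_mul _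

/-- A weak form of the easy half of the Erdős–Gallai theorem. -/
theorem sum_deg_le [DecidableEq V] (G : SimpleGraph V) (S : Finset V) :
    ∑ v ∈ S, deg G v ≤ #S * (#S - 1) + ∑ v ∈ Sᶜ, deg G v := by
  classical
  have split : ∀ v, deg G v = #{w ∈ S | G.Adj v w} + #{w ∈ Sᶜ | G.Adj v w} := fun v => by
    simp only [deg_eq_card, Finset.card_filter, Finset.sum_add_sum_compl]
  have inside : ∀ v ∈ S, #{w ∈ S | G.Adj v w} ≤ #S - 1 := fun v hv => by
    rw [← Finset.card_erase_of_mem hv]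
    refine Finset.card_le_card fun w hw => ?_
    rw [Finset.mem_filter] at hw
    exact Finset.mem_erase.2 ⟨hw.2.ne', hw.1⟩
  have outside : ∀ w, #{v ∈ S | G.Adj v w} ≤ deg G w := fun w => by
    simp only [deg_eq_card, G.adj_comm _ w]
    exact Finset.card_le_card (Finset.filter_subset_filter _ (Finset.subset_univ S))
  calc ∑ v ∈ S, deg G v
      = ∑ v ∈ S, #{w ∈ S | G.Adj v w} + ∑ v ∈ S, #{w ∈ Sᶜ | G.Adj v w} := by
        rw [← Finset.sum_add_distrib]
        exact Finset.sum_congr rfl fun v _ => split v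
    _ = ∑ v ∈ S, #{w ∈ S | G.Adj v w} + ∑ w ∈ Sᶜ, #{v ∈ S | G.Adj v w} := congrArg _ <|
        Finset.sum_card_bipartiteAbove_eq_sum_card_bipartiteBelow G.Adj
    _ ≤ #S * (#S - 1) + ∑ v ∈ Sᶜ, deg G v :=
        add_le_add (Finset.sum_le_card_nsmul _ _ _ inside)
          (Finset.sum_le_sum fun w _ => outside w)

end Degree

section Star

variable {V : Type*}

/-- The star joining `v` to the vertices of `A`. -/
def starGraph (v : V) (A : Finset V) : SimpleGraph V := (⊤ : SimpleGraph V).between {v} A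

theorem starGraph_adj {v x y : V} {A : Finset V} :
    (starGraph v A).Adj x y ↔ x ≠ y ∧ (x = v ∧ y ∈ A ∨ x ∈ A ∧ y = v) := by
  simp [starGraph, SimpleGraph.between_adj]

theorem deg_starGraph [Finite V] [DecidableEq V] {v : V} {A : Finset V} (hv : v ∉ A) (w : V) :
    deg (starGraph v A) w = if w = v then #A else if w ∈ A then 1 else 0 := by
  classical
  cases nonempty_fintype V
  rw [deg_eq_card]
  split_ifs with hwv hwA
  · congr 1
    ext x
    grind [starGraph_adj]
  · rw [Finset.card_eq_one]
    refine ⟨v, ?_⟩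
    ext x
    grind [starGraph_adj]
  · rw [Finset.card_eq_zero, Finset.filter_eq_empty_iff]
    grind [starGraph_adj]

end Star

section Switch

variable {V : Type*} {G : SimpleGraph V} {x z : V}

/-- The graph obtained from `G` by replacing the edges from `x` to `Q` and from `z` to `P` by edges
from `z` to `Q` and from `x` to `P`. -/
def switch (G : SimpleGraph V) (x z : V) (P Q : Finset V) : SimpleGraph V :=
  G \ (starGraph x Q ⊔ starGraph z P) ⊔ (starGraph z Q ⊔ starGraph x P)

theorem switch_adj {P Q : Finset V} {a b : V} : (switch G x z P Q).Adj a b ↔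
    G.Adj a b ∧ ¬ ((starGraph x Q).Adj a b ∨ (starGraph z P).Adj a b) ∨
      (starGraph z Q).Adj a b ∨ (starGraph x P).Adj a b := by
  simp [switch]

variable [Fintype V]

open Classical in
/-- The neighbours of `z` which are neither equal nor adjacent to `x`. -/
noncomputable def privateNbrs (G : SimpleGraph V) (z x : V) : Finset V :=
  {w | G.Adj z w ∧ ¬ G.Adj x w ∧ w ≠ x}

theorem mem_privateNbrs {w : V} : w ∈ privateNbrs G z x ↔ G.Adj z w ∧ ¬ G.Adj x w ∧ w ≠ x := by
  simp [privateNbrs]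

theorem deg_add_card_privateNbrs (G : SimpleGraph V) (x z : V) :
    deg G z + #(privateNbrs G x z) = deg G x + #(privateNbrs G z x) := by
  classical
  have key : ∀ a b : V, ({w | G.Adj a w} : Finset V).erase b \ ({w | G.Adj b w} : Finset V).erase a
      = privateNbrs G a b := fun a b => by
    ext w
    grind [mem_privateNbrs, G.irrefl]
  have hx := Finset.card_sdiff_add_card_inter (({w | G.Adj x w} : Finset V).erase z)
    (({w | G.Adj z w} : Finset V).erase x)
  have hz := Finset.card_sdiff_add_card_inter (({w | G.Adj z w} : Finset V).erase x)
    (({w | G.Adj x w} : Finset V).erase z)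
  rw [Finset.inter_comm] at hz
  rw [key] at hx hz
  simp only [Finset.card_erase_eq_ite, Finset.mem_filter_univ, G.adj_comm z x, ← deg_eq_card]
    at hx hz
  grind [deg_eq_zero_iff, G.adj_comm]

theorem deg_switch {P Q : Finset V} (hxz : x ≠ z) (hP : P ⊆ privateNbrs G z x)
    (hQ : Q ⊆ privateNbrs G x z) (hPQ : #P = #Q) (v : V) :
    deg (switch G x z P Q) v = deg G v := by
  classical
  have hP' : ∀ w ∈ P, G.Adj z w ∧ ¬ G.Adj x w ∧ w ≠ x := fun w hw => mem_privateNbrs.1 (hP hw)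
  have hQ' : ∀ w ∈ Q, G.Adj x w ∧ ¬ G.Adj z w ∧ w ≠ z := fun w hw => mem_privateNbrs.1 (hQ hw)
  have hzP : z ∉ P := fun h => G.irrefl (hP' z h).1
  have hxQ : x ∉ Q := fun h => G.irrefl (hQ' x h).1
  have hxP : x ∉ P := fun h => (hP' x h).2.2 rfl
  have hzQ : z ∉ Q := fun h => (hQ' z h).2.2 rfl
  have removed_le : starGraph x Q ⊔ starGraph z P ≤ G := by
    intro a b h
    simp only [SimpleGraph.sup_adj, starGraph_adj] at h
    grind [G.adj_comm]
  have added : Disjoint G (starGraph z Q ⊔ starGraph x P) := by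
    rw [SimpleGraph.disjoint_left]
    intro a b hab h
    simp only [SimpleGraph.sup_adj, starGraph_adj] at h
    grind [G.adj_comm]
  have old_disjoint : Disjoint (starGraph x Q) (starGraph z P) := by
    rw [SimpleGraph.disjoint_left]
    intro a b
    simp only [starGraph_adj]
    grind
  have new_disjoint : Disjoint (starGraph z Q) (starGraph x P) := by
    rw [SimpleGraph.disjoint_left]
    intro a b
    simp only [starGraph_adj]
    grind
  have same : deg (starGraph x Q ⊔ starGraph z P) v = deg (starGraph z Q ⊔ starGraph x P) v := by
    rw [deg_sup old_disjoint, deg_sup new_disjoint, deg_starGraph hxQ, deg_starGraph hzP,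
      deg_starGraph hzQ, deg_starGraph hxP]
    grind
  rw [switch, deg_sup (added.mono_left sdiff_le), ← same, deg_sdiff_add removed_le]

end Switch

section NearClique

variable {V L : Type*}

/-- Some graph with degree function `d` becomes complete on some `m` vertices once a copy of `H` is
added to it. -/
def HasNearClique (H : SimpleGraph L) (m : ℕ) (d : V → ℕ) : Prop :=
  ∃ G : SimpleGraph V, (∀ v, deg G v = d v) ∧
    ∃ T : Finset V, #T = m ∧ ∃ p : L ↪ V, (G ⊔ H.map p).IsClique T

theorem HasNearClique.comp_equiv {W : Type*} {H : SimpleGraph L} {m : ℕ} {d : V → ℕ} (e : W ≃ V)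
    (h : HasNearClique H m d) : HasNearClique H m (d ∘ e) := by
  obtain ⟨G, hG, T, hT, p, hp⟩ := h
  refine ⟨G.comap e, fun v => (deg_comap_equiv e G v).trans (hG _), T.map e.symm.toEmbedding,
    by rw [Finset.card_map, hT], p.trans e.symm.toEmbedding, ?_⟩
  intro a ha b hb hab
  simp only [Finset.coe_map, Set.mem_image, Finset.mem_coe, Equiv.coe_toEmbedding] at ha hb
  obtain ⟨a, ha, rfl⟩ := ha
  obtain ⟨b, hb, rfl⟩ := hb
  rcases hp ha hb (fun h => hab (congrArg _ h)) with h | h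
  · exact Or.inl (by simpa using h)
  · obtain ⟨x, y, hxy, rfl, rfl⟩ := (SimpleGraph.map_adj p H _ _).1 h
    exact Or.inr ((SimpleGraph.map_adj _ H _ _).2 ⟨x, y, hxy, rfl, rfl⟩)

theorem completeMinus_isContained {K W : Type*} [Fintype W] {H : SimpleGraph L}
    {U : SimpleGraph K} (hHU : H ⊑ U) (f : K ↪ W) {G : SimpleGraph V} {T : Finset V}
    (hT : #T = Fintype.card W) {p : L ↪ V} (hp : (G ⊔ H.map p).IsClique T) :
    completeMinus U f ⊑ G := by
  classical
  cases isEmpty_or_nonempty W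
  · exact SimpleGraph.IsContained.of_isEmpty
  obtain ⟨g⟩ := hHU
  let ψ : V → W := Function.extend p (fun l => f (g l)) (fun _ => Classical.arbitrary W)
  have hψ : ∀ l, ψ (p l) = f (g l) := p.injective.extend_apply _ _
  have hψ_inj : Set.InjOn (fun t : T => ψ t) {t | (t : V) ∈ Set.range p} := by
    rintro ⟨_, ha⟩ ⟨i, rfl⟩ ⟨_, hb⟩ ⟨j, rfl⟩ hij
    simp only [hψ, f.injective.eq_iff] at hij
    exact Subtype.ext (congrArg p (g.injective hij))
  obtain ⟨e, he⟩ := Set.MapsTo.exists_equiv_extend_of_card_eq (t := (Finset.univ : Finset W))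
    (by rw [Fintype.card_coe, hT, Finset.card_univ]) (fun _ _ => by simp) hψ_inj
  let e' : T ≃ W := e.trans (Equiv.subtypeUnivEquiv Finset.mem_univ)
  have he' : ∀ l (hl : p l ∈ T), e' ⟨p l, hl⟩ = f (g l) := fun l hl =>
    (he ⟨p l, hl⟩ ⟨l, rfl⟩).trans (hψ l)
  refine ⟨⟨⟨fun w => (e'.symm w : V), fun {a b} hab => ?_⟩,
    Subtype.val_injective.comp e'.symm.injective⟩⟩
  rw [completeMinus, SimpleGraph.compl_adj] at hab
  have hne : (e'.symm a : V) ≠ e'.symm b := fun h => hab.1 (e'.symm.injective (Subtype.ext h))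
  refine (hp (e'.symm a).2 (e'.symm b).2 hne).resolve_right fun hH => hab.2 ?_
  obtain ⟨i, j, hij, hi, hj⟩ := (SimpleGraph.map_adj p H _ _).1 hH
  have ha : f (g i) = a := by
    rw [← he' i (hi ▸ (e'.symm a).2)]
    simp [hi]
  have hb : f (g j) = b := by
    rw [← he' j (hj ▸ (e'.symm b).2)]
    simp [hj]
  exact (SimpleGraph.map_adj f U _ _).2 ⟨g i, g j, g.toHom.map_adj hij, ha, hb⟩

theorem map_trans_equiv_adj {H : SimpleGraph L} {p : L ↪ V} (σ : V ≃ V) {u v : V}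
    (h : (H.map p).Adj u v) : (H.map (p.trans σ.toEmbedding)).Adj (σ u) (σ v) := by
  obtain ⟨i, j, hij, rfl, rfl⟩ := (SimpleGraph.map_adj p H _ _).1 h
  exact (SimpleGraph.map_adj _ H _ _).2 ⟨i, j, hij, rfl, rfl⟩

variable [Finite V] {H : SimpleGraph L} {G : SimpleGraph V} {T : Finset V} {p : L ↪ V}

/-- The switch lets `x` take over the role of `z` in the near clique. -/
theorem exists_isClique_exchange [DecidableEq V] (hp : (G ⊔ H.map p).IsClique T) {x z : V}
    (hz : z ∈ T) (hx : x ∉ T) (hdeg : deg G z ≤ deg G x) :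
    ∃ G' : SimpleGraph V, (∀ v, deg G' v = deg G v) ∧
      ∃ p' : L ↪ V, (G' ⊔ H.map p').IsClique (insert x (T.erase z) : Finset V) := by
  cases nonempty_fintype V
  have hxz : x ≠ z := by rintro rfl; exact hx hz
  set P := {w ∈ privateNbrs G z x | w ∈ T}
  have hPQ : #P ≤ #(privateNbrs G x z) := by
    have := deg_add_card_privateNbrs G x z
    have : #P ≤ #(privateNbrs G z x) := Finset.card_filter_le _ _
    omega
  obtain ⟨Q, hQ, hQcard⟩ := Finset.exists_subset_card_eq hPQ
  have hG' := deg_switch hxz (Finset.filter_subset _ _) hQ hQcard.symm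
  refine ⟨switch G x z P Q, hG', p.trans (Equiv.swap x z).toEmbedding, ?_⟩
  have moved : ∀ u ∈ T.erase z, ((switch G x z P Q) ⊔
      H.map (p.trans (Equiv.swap x z).toEmbedding)).Adj x u := by
    intro u hu
    obtain ⟨huz, huT⟩ := Finset.mem_erase.1 hu
    have hux : u ≠ x := ne_of_mem_of_not_mem huT hx
    rcases hp hz huT huz.symm with h | h
    · left
      have huQ : u ∉ Q := fun hu => (mem_privateNbrs.1 (hQ hu)).2.1 h
      by_cases hxu : G.Adj x u
      · exact switch_adj.2 (Or.inl ⟨hxu, by grind [starGraph_adj]⟩)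
      · have huP : u ∈ P := Finset.mem_filter.2 ⟨mem_privateNbrs.2 ⟨h, hxu, hux⟩, huT⟩
        exact switch_adj.2 (Or.inr (Or.inr (starGraph_adj.2 ⟨hux.symm, Or.inl ⟨rfl, huP⟩⟩)))
    · have := map_trans_equiv_adj (Equiv.swap x z) h
      rw [Equiv.swap_apply_right, Equiv.swap_apply_of_ne_of_ne hux huz] at this
      exact Or.inr this
  have kept : ∀ u ∈ T.erase z, ∀ v ∈ T.erase z, u ≠ v → ((switch G x z P Q) ⊔
      H.map (p.trans (Equiv.swap x z).toEmbedding)).Adj u v := by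
    intro u hu v hv huv
    obtain ⟨huz, huT⟩ := Finset.mem_erase.1 hu
    obtain ⟨hvz, hvT⟩ := Finset.mem_erase.1 hv
    have hux : u ≠ x := ne_of_mem_of_not_mem huT hx
    have hvx : v ≠ x := ne_of_mem_of_not_mem hvT hx
    rcases hp huT hvT huv with h | h
    · exact Or.inl (switch_adj.2 (Or.inl ⟨h, by grind [starGraph_adj]⟩))
    · have := map_trans_equiv_adj (Equiv.swap x z) h
      rw [Equiv.swap_apply_of_ne_of_ne hux huz, Equiv.swap_apply_of_ne_of_ne hvx hvz] at this
      exact Or.inr this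
  rw [Finset.coe_insert, SimpleGraph.isClique_insert]
  exact ⟨fun u hu v hv => kept u hu v hv, fun u hu _ => moved u hu⟩

theorem exists_isClique_of_top_deg {X : Finset V} (hTX : #T = #X)
    (hX : ∀ x ∈ X, ∀ z ∉ X, deg G z ≤ deg G x) (hp : (G ⊔ H.map p).IsClique T) :
    ∃ G' : SimpleGraph V, (∀ v, deg G' v = deg G v) ∧
      ∃ p' : L ↪ V, (G' ⊔ H.map p').IsClique X := by
  classical
  induction hk : #(T \ X) generalizing G T p with
  | zero =>
    rw [Finset.card_eq_zero, Finset.sdiff_eq_empty_iff_subset] at hk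
    exact ⟨G, fun _ => rfl, p, Finset.eq_of_subset_of_card_le hk hTX.ge ▸ hp⟩
  | succ k ih =>
    obtain ⟨z, hz⟩ : (T \ X).Nonempty := Finset.card_pos.1 (by omega)
    obtain ⟨x, hx⟩ : (X \ T).Nonempty := Finset.card_pos.1 (by
      rw [← Finset.card_sdiff_eq_card_sdiff_iff.2 hTX]
      omega)
    rw [Finset.mem_sdiff] at hz hx
    obtain ⟨G₁, hG₁, p₁, hp₁⟩ := exists_isClique_exchange hp hz.1 hx.2 (hX x hx.1 z hz.2)
    have hcard : #(insert x (T.erase z)) = #T := by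
      rw [Finset.card_insert_of_notMem (fun h => hx.2 (Finset.mem_of_mem_erase h)),
        Finset.card_erase_add_one hz.1]
    have hdiff : insert x (T.erase z) \ X = (T \ X).erase z := by
      rw [Finset.insert_sdiff_of_mem _ hx.1, Finset.erase_sdiff_comm]
    obtain ⟨G₂, hG₂, p₂, hp₂⟩ := ih (hcard.trans hTX) (by simpa only [hG₁] using hX) hp₁
      (by rw [hdiff, Finset.card_erase_of_mem (Finset.mem_sdiff.2 hz), hk]; rfl)
    exact ⟨G₂, fun v => (hG₂ v).trans (hG₁ v), p₂, hp₂⟩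

end NearClique

theorem exists_subset_card_eq_of_largest {V : Type*} (f : V → ℕ) {O : Finset V} {k : ℕ}
    (hk : k ≤ #O) : ∃ A ⊆ O, #A = k ∧ ∀ a ∈ A, ∀ b ∈ O, b ∉ A → f b ≤ f a := by
  classical
  induction k with
  | zero => exact ⟨∅, by simp⟩
  | succ k ih =>
    obtain ⟨A, hA, hcard, htop⟩ := ih (by omega)
    obtain ⟨x, hx, hmax⟩ := Finset.exists_max_image (O \ A) f (Finset.card_pos.1 (by
      rw [Finset.card_sdiff_of_subset hA]; omega))
    rw [Finset.mem_sdiff] at hx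
    refine ⟨insert x A, Finset.insert_subset hx.1 hA, by
      rw [Finset.card_insert_of_notMem hx.2, hcard], ?_⟩
    intro a ha b hb hbA
    rw [Finset.mem_insert, not_or] at hbA
    rcases Finset.mem_insert.1 ha with rfl | ha
    · exact hmax b (Finset.mem_sdiff.2 ⟨hb, hbA.2⟩)
    · exact htop a ha b hb hbA.2

section DegreeFunction

variable {V : Type*}

/-- `b` is the degree function of some graph: the unordered version of a graphic sequence. -/
def IsDegreeFunction (b : V → ℕ) : Prop := ∃ G : SimpleGraph V, ∀ v, deg G v = b v

variable {b : V → ℕ} {v : V} {A : Finset V}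

theorem disjoint_starGraph [Finite V] {G : SimpleGraph V} (hv : deg G v = 0) :
    Disjoint G (starGraph v A) := by
  rw [deg_eq_zero_iff] at hv
  rw [SimpleGraph.disjoint_left]
  intro a c hac hstar
  rcases (starGraph_adj.1 hstar).2 with ⟨rfl, -⟩ | ⟨-, rfl⟩
  exacts [hv _ hac, hv _ hac.symm]

theorem IsDegreeFunction.of_sub_star [Finite V] (hle : ∀ w, deg (starGraph v A) w ≤ b w)
    (hv : deg (starGraph v A) v = b v)
    (h : IsDegreeFunction fun w => b w - deg (starGraph v A) w) : IsDegreeFunction b := by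
  obtain ⟨G, hG⟩ := h
  have hGv : deg G v = 0 := (hG v).trans (by simp [hv])
  exact ⟨G ⊔ starGraph v A, fun w => by
    rw [deg_sup (disjoint_starGraph hGv), (hG w : deg G w = _), Nat.sub_add_cancel (hle w)]⟩

variable [Fintype V]

/-- The values of `b` are at most `x`, and its `x + 1` largest values are `x` or `x - 1`. -/
def AlmostFlat (x : ℕ) (b : V → ℕ) : Prop := (∀ v, b v ≤ x) ∧ x + 1 ≤ #{v | x ≤ b v + 1}

variable {y : ℕ}

theorem AlmostFlat.of_ne (h : AlmostFlat (y + 1) b) (hne : ∀ v, b v ≠ y + 1) : AlmostFlat y b := by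
  refine ⟨fun v => by have := h.1 v; have := hne v; omega, ?_⟩
  refine (Nat.le_succ _).trans (h.2.trans (Finset.card_le_card fun v => ?_))
  simp only [Finset.mem_filter_univ]
  omega

theorem AlmostFlat.exists_largest (h : AlmostFlat (y + 1) b) (hv : b v = y + 1) :
    ∃ A : Finset V, v ∉ A ∧ #A = y + 1 ∧ (∀ a ∈ A, y ≤ b a) ∧
      ∀ a ∈ A, ∀ w, w ≠ v → w ∉ A → b w ≤ b a := by
  classical
  set X : Finset V := ({w | y + 1 ≤ b w + 1} : Finset V).erase v with hX
  have hXcard : y + 1 ≤ #X := by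
    have := h.2
    rw [hX, Finset.card_erase_of_mem (by simp [hv])]
    omega
  obtain ⟨A, hA, hAcard, htop⟩ := exists_subset_card_eq_of_largest b
    (hXcard.trans (Finset.card_le_card (Finset.erase_subset_erase v (Finset.subset_univ _))))
  refine ⟨A, fun hvA => Finset.notMem_erase v _ (hA hvA), hAcard, fun a ha => ?_,
    fun a ha w hwv hwA => htop a ha w (Finset.mem_erase.2 ⟨hwv, Finset.mem_univ w⟩) hwA⟩
  by_contra! hlt
  have haX : a ∉ X := by simp [hX]; omega
  obtain ⟨w, hwX, hwA⟩ : ∃ w ∈ X, w ∉ A.erase a := Finset.exists_mem_notMem_of_card_lt_card (by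
    rw [Finset.card_erase_of_mem ha]; omega)
  have hwy : y ≤ b w := by
    simp only [hX, Finset.mem_erase, Finset.mem_filter_univ] at hwX
    omega
  have hwv : w ∈ Finset.univ.erase v := Finset.erase_subset_erase v (Finset.subset_univ _) hwX
  have := htop a ha w hwv fun h =>
    hwA (Finset.mem_erase.2 ⟨ne_of_mem_of_not_mem hwX haX, h⟩)
  omega

theorem one_le_of_even_sum (he : Even (∑ w, b w)) (hv : b v = y + 1)
    (hA : #A = y + 1) (hAy : ∀ a ∈ A, y ≤ b a)
    (htop : ∀ a ∈ A, ∀ w, w ≠ v → w ∉ A → b w ≤ b a) :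
    ∀ a ∈ A, 1 ≤ b a := by
  intro a ha
  by_contra! hlt
  obtain rfl : y = 0 := by have := hAy a ha; omega
  obtain ⟨c, rfl⟩ := Finset.card_eq_one.1 hA
  obtain rfl := Finset.mem_singleton.1 ha
  have hzero : ∀ w, w ≠ v → b w = 0 := fun w hwv => by
    rcases eq_or_ne w a with hwa | hwa
    · subst hwa; omega
    · have := htop a ha w hwv (by simpa using hwa)
      omega
  rw [Fintype.sum_eq_single v hzero, hv] at he
  exact absurd he (by decide)

/-- If the maximum is still attained at `w` after the star is removed, then all values on `A` were
maximal, since `A` was preferred to `w`. -/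
theorem AlmostFlat.sub_star (h : AlmostFlat (y + 1) b) (hv : b v = y + 1)
    (hvA : v ∉ A) (hA : #A = y + 1) (hAy : ∀ a ∈ A, y ≤ b a)
    (htop : ∀ a ∈ A, ∀ w, w ≠ v → w ∉ A → b w ≤ b a) :
    ∃ x ≤ y + 1, AlmostFlat x fun w => b w - deg (starGraph v A) w := by
  classical
  have hle : ∀ w, b w - deg (starGraph v A) w ≤ y + 1 := fun w => (Nat.sub_le _ _).trans (h.1 w)
  simp only [AlmostFlat, deg_starGraph hvA] at hle ⊢
  by_cases hw : ∃ w, b w - (if w = v then #A else if w ∈ A then 1 else 0) = y + 1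
  · obtain ⟨w, hw⟩ := hw
    have hwv : w ≠ v := by rintro rfl; simp [hA] at hw; omega
    have hwA : w ∉ A := fun hwA => by have := h.1 w; simp [hwv, hwA] at hw; omega
    refine ⟨y + 1, le_rfl, hle, ?_⟩
    rw [← hA, ← Finset.card_insert_of_notMem hwA]
    refine Finset.card_le_card fun u hu => ?_
    rw [Finset.mem_filter_univ]
    rcases Finset.mem_insert.1 hu with rfl | hu
    · omega
    · have := htop u hu w hwv hwA
      grind
  · push Not at hw
    refine ⟨y, by omega, fun w => by have := hle w; have := hw w; omega, ?_⟩
    rw [← hA]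
    refine Finset.card_le_card fun u hu => ?_
    rw [Finset.mem_filter_univ]
    grind

theorem AlmostFlat.isDegreeFunction {x : ℕ} (h : AlmostFlat x b) (he : Even (∑ v, b v)) :
    IsDegreeFunction b := by
  classical
  induction hk : ∑ v, b v + x using Nat.strong_induction_on generalizing b x with
  | _ k ih =>
  subst hk
  rcases x with _ | y
  · exact ⟨⊥, fun v => by simp [deg_eq_card, Nat.le_zero.1 (h.1 v)]⟩
  by_cases hv : ∃ v, b v = y + 1
  swap
  · exact ih _ (by omega) (h.of_ne (not_exists.1 hv)) he rfl
  obtain ⟨v, hv⟩ := hv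
  obtain ⟨A, hvA, hA, hAy, htop⟩ := h.exists_largest hv
  have hpos := one_le_of_even_sum he hv hA hAy htop
  have hstar_v : deg (starGraph v A) v = b v := by simp [deg_starGraph hvA, hA, hv]
  have hle : ∀ w, deg (starGraph v A) w ≤ b w := fun w => by
    rw [deg_starGraph hvA]
    grind
  have hsum : ∑ w, (b w - deg (starGraph v A) w) + ∑ w, deg (starGraph v A) w = ∑ w, b w := by
    rw [← Finset.sum_add_distrib]
    exact Finset.sum_congr rfl fun w _ => Nat.sub_add_cancel (hle w)
  have hlarge : y + 1 ≤ ∑ w, deg (starGraph v A) w := by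
    rw [← hv, ← hstar_v]
    exact Finset.single_le_sum_of_canonicallyOrdered (f := deg _) (Finset.mem_univ v)
  obtain ⟨x, hx, hflat⟩ := h.sub_star hv hvA hA hAy htop
  refine IsDegreeFunction.of_sub_star hle hstar_v (ih _ (by omega) hflat ?_ rfl)
  exact (Nat.even_add.1 (hsum.symm ▸ he)).2 (even_sum_deg _)

end DegreeFunction

theorem exists_adj_top {V : Type*} [Finite V] {G : SimpleGraph V} {u : V} {X : Finset V}
    (hu : u ∉ X) (hcard : #X ≤ deg G u)
    (hX : ∀ x ∈ X, ∀ y ∉ X, y ≠ u → deg G y < deg G x) :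
    ∃ G' : SimpleGraph V, (∀ v, deg G' v = deg G v) ∧ ∀ x ∈ X, G'.Adj u x := by
  classical
  cases nonempty_fintype V
  induction hk : #{x ∈ X | ¬ G.Adj u x} using Nat.strong_induction_on generalizing G with
  | _ k ih =>
  subst hk
  by_cases hall : ∀ x ∈ X, G.Adj u x
  · exact ⟨G, fun _ => rfl, hall⟩
  push Not at hall
  obtain ⟨x, hx, hux⟩ := hall
  have hxu : x ≠ u := ne_of_mem_of_not_mem hx hu
  obtain ⟨y, huy, hy⟩ : ∃ y, G.Adj u y ∧ y ∉ X := by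
    by_contra! h
    have : ({y | G.Adj u y} : Finset V) ⊆ X.erase x := fun y hy => by
      rw [Finset.mem_filter_univ] at hy
      exact Finset.mem_erase.2 ⟨fun hyx => hux (hyx ▸ hy), h y hy⟩
    have := Finset.card_le_card this
    rw [← deg_eq_card, Finset.card_erase_of_mem hx] at this
    have := Finset.card_pos.2 ⟨x, hx⟩
    omega
  have hxy : x ≠ y := ne_of_mem_of_not_mem hx hy
  have huP : u ∈ privateNbrs G y x := mem_privateNbrs.2 ⟨huy.symm, fun h => hux h.symm, hxu.symm⟩
  obtain ⟨p, hp⟩ : (privateNbrs G x y).Nonempty := Finset.card_pos.1 (by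
    have := deg_add_card_privateNbrs G x y
    have := hX x hx y hy huy.ne'
    omega)
  have hpu : p ≠ u := fun h => hux (h ▸ (mem_privateNbrs.1 hp).1).symm
  have hdeg := deg_switch hxy (Finset.singleton_subset_iff.2 huP)
    (Finset.singleton_subset_iff.2 hp) rfl
  have hlt : ({w ∈ X | ¬ (switch G x y {u} {p}).Adj u w} : Finset V) ⊂ {w ∈ X | ¬ G.Adj u w} := by
    refine (Finset.ssubset_iff_of_subset fun w hw => ?_).2 ⟨x, by simp [hx, hux], ?_⟩
    · simp only [Finset.mem_filter, switch_adj, starGraph_adj, Finset.mem_singleton] at hw ⊢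
      grind
    · simp [switch_adj, starGraph_adj, hxu.symm]
  obtain ⟨G', hG', hadj⟩ := ih _ (Finset.card_lt_card hlt) (by rwa [hdeg])
    (by simpa only [hdeg] using hX) rfl
  exact ⟨G', fun v => (hG' v).trans (hdeg v), hadj⟩

section Balanced

variable {V : Type*} {O A : Finset V} {a b : V → ℕ} {m k : ℕ}

/-- `a` arises from `b` on `O` by lowering only largest values: a lowered value is at least the
maximum of `a` minus one. -/
def IsBalancedBelow (O : Finset V) (b a : V → ℕ) : Prop :=
  (∀ v ∈ O, a v ≤ b v) ∧ ∀ w ∈ O, a w < b w → ∀ v ∈ O, a v ≤ a w + 1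

theorem starGraph_le_between {T : Finset V} {t : V} (ht : t ∈ T) (hA : A ⊆ O) :
    starGraph t A ≤ (⊤ : SimpleGraph V).between T O := by
  intro u w
  rw [starGraph_adj, SimpleGraph.between_adj]
  rintro ⟨huw, ⟨rfl, hw⟩ | ⟨hu, rfl⟩⟩
  exacts [⟨huw, Or.inl ⟨ht, hA hw⟩⟩, ⟨huw, Or.inr ⟨hA hu, ht⟩⟩]

theorem exists_mem_notMem_of_card_le (hAcard : #A ≤ #{v ∈ O | b v = m}) {w : V} (hw : w ∈ A)
    (hwm : w ∈ O → b w ≠ m) : ∃ z ∈ O, b z = m ∧ z ∉ A := by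
  classical
  obtain ⟨z, hz, hzA⟩ : ∃ z ∈ ({v ∈ O | b v = m} : Finset V), z ∉ A.erase w :=
    Finset.exists_mem_notMem_of_card_lt_card (by
      have := Finset.card_pos.2 ⟨w, hw⟩
      rw [Finset.card_erase_of_mem hw]
      omega)
  rw [Finset.mem_filter] at hz
  exact ⟨z, hz.1, hz.2, fun hzA' =>
    hzA (Finset.mem_erase.2 ⟨by rintro rfl; exact hwm hz.1 hz.2, hzA'⟩)⟩

theorem IsBalancedBelow.one_le (h : IsBalancedBelow O b a) (hb : ∀ v ∈ O, b v ≤ m) (hA : A ⊆ O)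
    (hAcard : #A ≤ #{v ∈ O | b v = m}) (hsum : #A ≤ ∑ v ∈ O, a v)
    (htop : ∀ w ∈ A, ∀ v ∈ O, v ∉ A → a v ≤ a w) : ∀ w ∈ A, 1 ≤ a w := by
  intro w hw
  by_contra! hw0
  have hle : ∀ v ∈ O, a v ≤ 1 := by
    obtain ⟨z, hzO, hzm, hz⟩ : ∃ z ∈ O, b z = m ∧ a z = 0 := by
      by_cases hwm : b w = m
      · exact ⟨w, hA hw, hwm, by omega⟩
      · obtain ⟨z, hzO, hzm, hzA⟩ := exists_mem_notMem_of_card_le hAcard hw fun _ => hwm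
        have := htop w hw z hzO hzA
        exact ⟨z, hzO, hzm, by omega⟩
    intro v hv
    have := hb v hv
    have := h.1 v hv
    rcases Nat.eq_zero_or_pos m with hm | hm
    · omega
    · have := h.2 z hzO (by omega) v hv
      omega
  have hlt : ∑ v ∈ O, a v < #A := by
    rw [← Finset.sum_subset hA fun v hv hvA => by have := htop w hw v hv hvA; omega,
      Finset.card_eq_sum_ones]
    exact Finset.sum_lt_sum (fun v hv => hle v (hA hv)) ⟨w, hw, hw0⟩
  omega

theorem IsBalancedBelow.lower [DecidableEq V] (h : IsBalancedBelow O b a)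
    (hb : ∀ v ∈ O, b v ≤ m) (hA : A ⊆ O) (hAcard : #A ≤ #{v ∈ O | b v = m})
    (hpos : ∀ w ∈ A, 1 ≤ a w) (htop : ∀ w ∈ A, ∀ v ∈ O, v ∉ A → a v ≤ a w) :
    IsBalancedBelow O b fun v => a v - if v ∈ A then 1 else 0 := by
  have hmax : ∀ w ∈ A, ∀ v ∈ O, a v ≤ a w + 1 := by
    intro w hw v hv
    have := h.1 v hv
    have := hb v hv
    by_cases hlt : a w < b w
    · exact h.2 w (hA hw) hlt v hv
    by_cases hwm : b w = m
    · omega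
    obtain ⟨z, hzO, hzm, hzA⟩ := exists_mem_notMem_of_card_le hAcard hw fun _ => hwm
    have := htop w hw z hzO hzA
    have := hb w (hA hw)
    have := h.1 w (hA hw)
    have := h.2 z hzO (by omega) v hv
    omega
  refine ⟨fun v hv => (Nat.sub_le _ _).trans (h.1 v hv), fun w hw hlt v hv => ?_⟩
  by_cases hwA : w ∈ A
  · have := hpos w hwA
    have := hmax w hwA v hv
    by_cases hvA : v ∈ A
    · simp only [hwA, hvA, if_true]
      omega
    · have := htop w hwA v hv hvA
      simp only [hwA, hvA, if_true, if_false]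
      omega
  · simp only [hwA, if_false, Nat.sub_zero] at hlt ⊢
    exact (Nat.sub_le _ _).trans (h.2 w hw hlt v hv)

theorem IsBalancedBelow.exists_lower [DecidableEq V] (h : IsBalancedBelow O b a)
    (hb : ∀ v ∈ O, b v ≤ m) (hk : k ≤ #{v ∈ O | b v = m})
    (hsum : k ≤ ∑ v ∈ O, a v) :
    ∃ A ⊆ O, #A = k ∧ (∀ w ∈ A, 1 ≤ a w) ∧
      IsBalancedBelow O b fun v => a v - if v ∈ A then 1 else 0 := by
  obtain ⟨A, hA, rfl, htop⟩ :=
    exists_subset_card_eq_of_largest a (hk.trans (Finset.card_filter_le _ _))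
  have hpos := h.one_le hb hA hk hsum htop
  exact ⟨A, hA, rfl, hpos, h.lower hb hA hk hpos htop⟩

theorem sup_starGraph_le_between_insert [DecidableEq V] {T : Finset V} {G : SimpleGraph V} {t : V}
    (hG : G ≤ (⊤ : SimpleGraph V).between T O) (hA : A ⊆ O) :
    G ⊔ starGraph t A ≤ (⊤ : SimpleGraph V).between (insert t T : Finset V) O := by
  refine sup_le (hG.trans fun u w huw => ?_)
    (starGraph_le_between (Finset.mem_insert_self t T) hA)
  rw [SimpleGraph.between_adj] at huw ⊢
  simp only [Finset.coe_insert, Set.mem_insert_iff]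
  tauto

/-- One vertex of `T` after the other is joined to the vertices of `O` with the largest remaining
demand. -/
theorem exists_between_deg_eq [Finite V] {T : Finset V} {c : V → ℕ} (hTO : Disjoint T O)
    (hb : ∀ v ∈ O, b v ≤ m) (hc : ∀ t ∈ T, c t ≤ #{v ∈ O | b v = m})
    (hsum : ∑ t ∈ T, c t ≤ ∑ v ∈ O, b v) :
    ∃ (G : SimpleGraph V) (a : V → ℕ), G ≤ (⊤ : SimpleGraph V).between T O ∧
      (∀ t ∈ T, deg G t = c t) ∧ (∀ v ∈ O, deg G v + a v = b v) ∧
      ∑ v ∈ O, a v + ∑ t ∈ T, c t = ∑ v ∈ O, b v ∧ IsBalancedBelow O b a := by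
  classical
  cases nonempty_fintype V
  induction T using Finset.induction_on with
  | empty =>
    exact ⟨⊥, b, bot_le, by simp, fun v _ => by simp [deg_eq_card], by simp, fun v _ => le_rfl,
      fun w _ hlt => absurd hlt (lt_irrefl _)⟩
  | insert t T ht ih =>
    rw [Finset.sum_insert ht] at hsum
    obtain ⟨htO, hTO⟩ := Finset.disjoint_insert_left.1 hTO
    obtain ⟨G, a, hG, hGT, hGO, hGsum, hbal⟩ := ih hTO
      (fun s hs => hc s (Finset.mem_insert_of_mem hs)) (by omega)
    obtain ⟨A, hA, hAt, hpos, hlow⟩ :=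
      hbal.exists_lower hb (hc t (Finset.mem_insert_self _ _)) (by omega)
    have htA : t ∉ A := fun h => htO (hA h)
    have hGt : deg G t = 0 := deg_eq_zero_iff.2 fun w hw =>
      (SimpleGraph.between_adj.1 (hG hw)).2.elim (fun h => ht h.1) fun h => htO h.1
    have hdeg : ∀ v, deg (G ⊔ starGraph t A) v =
        deg G v + if v = t then #A else if v ∈ A then 1 else 0 := fun v => by
      rw [deg_sup (disjoint_starGraph hGt), deg_starGraph htA]
    refine ⟨G ⊔ starGraph t A, fun v => a v - if v ∈ A then 1 else 0,
      sup_starGraph_le_between_insert hG hA, fun s hs => ?_, fun v hv => ?_, ?_, hlow⟩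
    · rw [hdeg]
      rcases Finset.mem_insert.1 hs with rfl | hs
      · rw [if_pos rfl, hGt, hAt, zero_add]
      · rw [if_neg (ne_of_mem_of_not_mem hs ht),
          if_neg fun h => Finset.disjoint_left.1 hTO hs (hA h), hGT s hs, add_zero]
    · rw [hdeg, if_neg (ne_of_mem_of_not_mem hv htO), ← hGO v hv]
      have := hpos v
      grind
    · have hAsum : ∑ v ∈ O, (if v ∈ A then 1 else 0) = #A := by
        rw [Finset.sum_boole, Finset.filter_mem_eq_inter, Finset.inter_eq_right.2 hA, Nat.cast_id]
      rw [Finset.sum_insert ht, ← hGsum, ← hAt, ← add_assoc, ← hAsum, ← Finset.sum_add_distrib]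
      exact congrArg (· + _) (Finset.sum_congr rfl fun v _ => by have := hpos v; grind)

end Balanced

section CliqueRealization

variable {V : Type*} {O : Finset V} {a b : V → ℕ} {m x : ℕ} {w : V}

theorem IsBalancedBelow.card_filter_le (h : IsBalancedBelow O b a) (hw : w ∈ O) :
    #{v ∈ O | a w ≤ b v + 1} ≤ #{v ∈ O | a w ≤ a v + 1} := by
  refine Finset.card_le_card fun v hv => ?_
  rw [Finset.mem_filter] at hv ⊢
  refine ⟨hv.1, ?_⟩
  rcases (h.1 v hv.1).lt_or_eq with hlt | heq
  · exact h.2 v hv.1 hlt w hw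
  · exact heq ▸ hv.2

theorem IsBalancedBelow.sum_lt (h : IsBalancedBelow O b a) (hb : ∀ v ∈ O, b v ≤ m) (hw : w ∈ O) :
    ∑ v ∈ O, b v < ∑ v ∈ O, a v + #{v ∈ O | a w ≤ a v + 1} * (m + 1 - a w) := by
  have hcard : #{v ∈ O | a w ≤ a v + 1} * (m + 1 - a w) =
      ∑ v ∈ O, if a w ≤ a v + 1 then m + 1 - a w else 0 := by
    rw [← Finset.sum_filter, Finset.sum_const, smul_eq_mul]
  rw [hcard, ← Finset.sum_add_distrib]
  refine Finset.sum_lt_sum (fun v hv => ?_) ⟨w, hw, ?_⟩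
  · have := hb v hv
    split_ifs with hvw
    · omega
    · by_contra hlt
      exact hvw (h.2 v hv (by omega) w hw)
  · have := hb w hw
    have := h.1 w hw
    rw [if_pos (Nat.le_succ _)]
    omega

theorem deg_between_self [Finite V] [DecidableEq V] (T : Finset V) (t : V) :
    deg ((⊤ : SimpleGraph V).between T T) t = if t ∈ T then #T - 1 else 0 := by
  classical
  cases nonempty_fintype V
  rw [deg_eq_card]
  split_ifs with ht
  · rw [← Finset.card_erase_of_mem ht]
    congr 1
    ext w
    simp only [Finset.mem_filter_univ, SimpleGraph.between_adj, Finset.mem_erase, Finset.mem_coe,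
      SimpleGraph.top_adj]
    tauto
  · rw [Finset.card_eq_zero, Finset.filter_eq_empty_iff]
    simp [SimpleGraph.between_adj, ht]

variable [Fintype V] {T : Finset V} {E : SimpleGraph V} {d c : V → ℕ} {r : ℕ}

theorem sum_deg_eq_of_le_between (hE : E ≤ (⊤ : SimpleGraph V).between T T) :
    ∑ v, deg E v = ∑ v ∈ T, deg E v :=
  (Finset.sum_subset (Finset.subset_univ T) fun _ _ hv => deg_eq_zero_iff.2 fun _ hw =>
    hv ((SimpleGraph.between_adj.1 (hE hw)).2.elim And.left And.left)).symm

variable [DecidableEq V]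

/-- The demands left over after joining `T` to `Tᶜ`. -/
theorem exists_residual_deg_eq (hT : #T = r + 1)
    (hE : E ≤ (⊤ : SimpleGraph V).between T T) (hd : Even (∑ v, d v))
    (hc : ∀ t ∈ T, d t + deg E t = r + c t)
    (hsum : ∑ v ∈ Tᶜ, a v + ∑ t ∈ T, c t = ∑ v ∈ Tᶜ, d v)
    (hw : ∀ v ∈ Tᶜ, a v ≤ x) (hcard : x + 1 ≤ #{v ∈ Tᶜ | x ≤ a v + 1}) :
    IsDegreeFunction fun v => if v ∈ T then 0 else a v := by
  refine AlmostFlat.isDegreeFunction (x := x) ⟨fun v => ?_, hcard.trans ?_⟩ ?_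
  · dsimp only
    split_ifs with hv
    · exact Nat.zero_le _
    · exact hw v (Finset.mem_compl.2 hv)
  · refine Finset.card_le_card fun v hv => ?_
    rw [Finset.mem_filter, Finset.mem_compl] at hv
    simp [hv]
  · have hsplit : ∑ v, (if v ∈ T then 0 else a v) = ∑ v ∈ Tᶜ, a v := by
      rw [← Finset.sum_add_sum_compl T, Finset.sum_eq_zero fun v hv => if_pos hv, zero_add]
      exact Finset.sum_congr rfl fun v hv => if_neg (Finset.mem_compl.1 hv)
    have hcsum := Finset.sum_congr rfl hc
    have hEeven := even_sum_deg E
    have hr := Nat.even_mul_succ_self r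
    rw [Finset.sum_add_distrib, Finset.sum_add_distrib, Finset.sum_const, hT, smul_eq_mul,
      mul_comm, ← sum_deg_eq_of_le_between hE] at hcsum
    rw [← Finset.sum_add_sum_compl T] at hd
    rw [hsplit]
    rw [Nat.even_iff] at *
    omega

theorem exists_deg_eq_sup (hT : #T = r + 1) (hE : E ≤ (⊤ : SimpleGraph V).between T T)
    (hc : ∀ t ∈ T, d t + deg E t = r + c t)
    {B D : SimpleGraph V} (hB : B ≤ (⊤ : SimpleGraph V).between T Tᶜ)
    (hBT : ∀ t ∈ T, deg B t = c t) (hBO : ∀ v ∈ Tᶜ, deg B v + a v = d v)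
    (hD : ∀ v, deg D v = if v ∈ T then 0 else a v) :
    ∀ v, deg ((⊤ : SimpleGraph V).between T T \ E ⊔ (B ⊔ D)) v = d v := by
  have hDT : ∀ t ∈ T, ∀ w, ¬ D.Adj t w := fun t ht => deg_eq_zero_iff.1 (by rw [hD, if_pos ht])
  have hBD : Disjoint B D := SimpleGraph.disjoint_left.2 fun u w hu h =>
    (SimpleGraph.between_adj.1 (hB hu)).2.elim (fun hT => hDT u hT.1 w h)
      fun hT => hDT w hT.2 u h.symm
  have hKBD : Disjoint ((⊤ : SimpleGraph V).between T T) (B ⊔ D) := by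
    refine SimpleGraph.disjoint_left.2 fun u w hK h => ?_
    rw [SimpleGraph.between_adj] at hK
    rcases h with h | h
    · have := (SimpleGraph.between_adj.1 (hB h)).2
      simp only [Set.mem_compl_iff] at this
      tauto
    · exact hDT u (by tauto) w h
  intro v
  have hK := deg_sdiff_add hE v
  rw [deg_between_self, hT] at hK
  rw [deg_sup (hKBD.mono_left sdiff_le), deg_sup hBD, hD]
  by_cases hv : v ∈ T
  · have := hc v hv
    rw [if_pos hv] at hK ⊢
    rw [hBT v hv]
    omega
  · have := hBO v (Finset.mem_compl.2 hv)
    rw [if_neg hv] at hK ⊢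
    omega

/-- After joining `T` to `Tᶜ` in a balanced way, the remaining demands have a maximum `x`, and
`hmax` makes them almost flat. -/
theorem exists_isClique_sup (hT : #T = r + 1) (hTne : Tᶜ.Nonempty)
    (hE : E ≤ (⊤ : SimpleGraph V).between T T) (hd : Even (∑ v, d v))
    (hc : ∀ t ∈ T, d t + deg E t = r + c t) (hdm : ∀ v ∈ Tᶜ, d v ≤ m)
    (hcm : ∀ t ∈ T, c t ≤ #{v ∈ Tᶜ | d v = m}) (hsum : ∑ t ∈ T, c t ≤ ∑ v ∈ Tᶜ, d v)
    (hmax : ∀ x ≤ m, ∀ N, #{v ∈ Tᶜ | x ≤ d v + 1} ≤ N →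
      ∑ t ∈ T, c t < N * (m + 1 - x) → x + 1 ≤ N) :
    ∃ G : SimpleGraph V, (∀ v, deg G v = d v) ∧ (G ⊔ E).IsClique T := by
  obtain ⟨B, a, hB, hBT, hBO, hasum, hbal⟩ :=
    exists_between_deg_eq disjoint_compl_right hdm hcm hsum
  obtain ⟨w, hw, hle⟩ := Finset.exists_max_image Tᶜ a hTne
  have hcard : a w + 1 ≤ #{v ∈ Tᶜ | a w ≤ a v + 1} :=
    hmax _ ((hbal.1 w hw).trans (hdm w hw)) _ (hbal.card_filter_le hw)
      (by have := hbal.sum_lt hdm hw; omega)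
  obtain ⟨D, hD⟩ := exists_residual_deg_eq hT hE hd hc hasum hle hcard
  rw [Finset.coe_compl] at hB
  refine ⟨_, exists_deg_eq_sup hT hE hc hB hBT hBO hD, fun u hu w hw huw => ?_⟩
  by_cases hEuw : E.Adj u w
  · exact Or.inr hEuw
  · exact Or.inl (Or.inl ⟨SimpleGraph.between_adj.2 ⟨huw, Or.inl ⟨hu, hw⟩⟩, hEuw⟩)

end CliqueRealization

theorem exists_embedding_extending {ι L W : Type*} [Finite ι] [Fintype L] [Fintype W]
    (hLW : Fintype.card L ≤ Fintype.card W) (f : ι ↪ L) (g : ι ↪ W) :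
    ∃ p : L ↪ W, f.trans p = g := by
  obtain ⟨k⟩ := Function.Embedding.nonempty_of_card_le hLW
  obtain ⟨σ, hσ⟩ := Equiv.Perm.exists_smul_eq_embedding (f.trans k) g
  exact ⟨k.trans σ.toEmbedding, hσ⟩

theorem sum_deg_map {V W : Type*} [Fintype V] [Fintype W] (p : V ↪ W) (G : SimpleGraph V) :
    ∑ w, deg (G.map p) w = ∑ v, deg G v :=
  (Fintype.sum_of_injective p p.injective _ _ (fun _ => deg_map_of_notMem_range G)
    fun v => (deg_map p G v).symm).symm

section PartialSum

/-- The sum of the first `k` terms of `D`, as an integer so that it can be subtracted. -/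
def partialSum (D : ℕ → ℕ) (k : ℕ) : ℤ := ∑ i ∈ Finset.range k, (D i : ℤ)

variable {D : ℕ → ℕ} {a b : ℕ} {y : ℤ}

theorem partialSum_zero (D : ℕ → ℕ) : partialSum D 0 = 0 := Finset.sum_range_zero _

theorem partialSum_succ (D : ℕ → ℕ) (k : ℕ) : partialSum D (k + 1) = partialSum D k + D k :=
  Finset.sum_range_succ _ _

theorem partialSum_mono (D : ℕ → ℕ) : Monotone (partialSum D) :=
  monotone_nat_of_le_succ fun k => by
    rw [partialSum_succ]
    omega

theorem partialSum_le_of_antitone (hD : Antitone D) (hab : a ≤ b) (hy : (D a : ℤ) ≤ y) :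
    partialSum D b ≤ partialSum D a + ((b : ℤ) - a) * y := by
  induction b, hab using Nat.le_induction with
  | base => simp
  | succ b hab ih =>
    have : (D b : ℤ) ≤ D a := by exact_mod_cast hD hab
    rw [partialSum_succ]
    push_cast
    linarith

theorem le_partialSum_of_antitone (hD : Antitone D) (hab : a ≤ b) (hy : y ≤ D b) :
    partialSum D a + ((b : ℤ) + 1 - a) * y ≤ partialSum D (b + 1) := by
  induction b, hab using Nat.le_induction with
  | base =>
    rw [partialSum_succ]
    linarith
  | succ b _ ih =>
    have hb : (D (b + 1) : ℤ) ≤ D b := by exact_mod_cast hD b.le_succ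
    have := ih (hy.trans hb)
    rw [partialSum_succ]
    push_cast
    linarith

variable {n : ℕ}

/-- The vertices `0, …, k - 1` of `Fin n`. -/
def firstVertices (n k : ℕ) : Finset (Fin n) := {v | v.val < k}

theorem mem_firstVertices {k : ℕ} {v : Fin n} : v ∈ firstVertices n k ↔ v.val < k :=
  Finset.mem_filter_univ v

theorem sum_firstVertices (D : ℕ → ℕ) {k : ℕ} (hk : k ≤ n) :
    ((∑ v ∈ firstVertices n k, D v : ℕ) : ℤ) = partialSum D k := by
  rw [firstVertices, Finset.sum_filter,
    Fin.sum_univ_eq_sum_range (fun i => if i < k then D i else 0), ← Finset.sum_filter, partialSum]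
  push_cast
  congr 1
  ext i
  simp only [Finset.mem_filter, Finset.mem_range]
  omega

theorem card_firstVertices {k : ℕ} (hk : k ≤ n) : #(firstVertices n k) = k := by
  have := sum_firstVertices (n := n) (fun _ => 1) hk
  simpa [partialSum] using this

theorem sum_compl_firstVertices (D : ℕ → ℕ) {k : ℕ} (hk : k ≤ n) :
    partialSum D k + (∑ v ∈ (firstVertices n k)ᶜ, D v : ℕ) =
      partialSum D n := by
  rw [← sum_firstVertices D hk, ← Nat.cast_add, Finset.sum_add_sum_compl,
    Fin.sum_univ_eq_sum_range, partialSum, Nat.cast_sum]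

theorem two_mul_partialSum_le {G : SimpleGraph (Fin n)} (hG : ∀ v : Fin n, deg G v = D v) {k : ℕ}
    (hk : k ≤ n) : 2 * partialSum D k ≤ (k : ℤ) * (k - 1) + partialSum D n := by
  have h := sum_deg_le G (firstVertices n k)
  simp only [hG, card_firstVertices hk] at h
  have h1 := sum_firstVertices D hk
  have h2 := sum_compl_firstVertices D hk
  have h3 : (k : ℤ) * (k - 1) = (k * (k - 1) : ℕ) := by cases k <;> simp
  omega

end PartialSum

section Antitone

variable {n r s : ℕ}

/-- The positions `r, r - 1, …, r - s + 1`. -/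
def lastPositions (hs : s ≤ r + 1) (hrn : r < n) : Fin s ↪ Fin n :=
  ⟨fun j => ⟨r - j, by omega⟩, fun i j h => Fin.ext (by
    have := congrArg Fin.val h
    simp only at this
    omega)⟩

variable {hs : s ≤ r + 1} {hrn : r < n}

theorem deg_map_lastPositions (M : SimpleGraph (Fin s)) (j : Fin s) {v : Fin n}
    (hv : v.val = r - j) : deg (M.map (lastPositions hs hrn)) v = deg M j :=
  (congrArg _ (Fin.ext hv)).trans (deg_map (lastPositions hs hrn) M j)

theorem deg_map_lastPositions_of_notMem (M : SimpleGraph (Fin s)) {v : Fin n}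
    (hv : v.val + s ≤ r ∨ r < v) : deg (M.map (lastPositions hs hrn)) v = 0 :=
  deg_map_of_notMem_range M fun ⟨j, hj⟩ => by
    have hjv : r - j.val = v := congrArg Fin.val hj
    omega

theorem map_lastPositions_le_between (M : SimpleGraph (Fin s)) :
    M.map (lastPositions hs hrn) ≤ (⊤ : SimpleGraph (Fin n)).between
      (firstVertices n (r + 1)) (firstVertices n (r + 1)) := by
  have hpos : ∀ j, lastPositions hs hrn j ∈ firstVertices n (r + 1) := fun j =>
    mem_firstVertices.2 (Nat.lt_succ_of_le (Nat.sub_le r j))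
  rintro _ _ ⟨hne, i, j, -, rfl, rfl⟩
  simp [SimpleGraph.between_adj, hne, hpos]

theorem sum_deg_map_lastPositions (M : SimpleGraph (Fin s)) :
    ∑ v ∈ firstVertices n (r + 1), deg (M.map (lastPositions hs hrn)) v = ∑ j, deg M j := by
  rw [← sum_deg_map (lastPositions hs hrn) M]
  refine Finset.sum_subset (Finset.subset_univ _) fun v _ hv => ?_
  rw [mem_firstVertices] at hv
  exact deg_map_lastPositions_of_notMem M (.inr (by omega))

theorem exists_map_lastPositions_le {L : Type*} [Fintype L] {H : SimpleGraph L}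
    {M : SimpleGraph (Fin s)} (hMH : M ⊑ H) (hL : Fintype.card L ≤ n) :
    ∃ p : L ↪ Fin n, M.map (lastPositions hs hrn) ≤ H.map p := by
  obtain ⟨f⟩ := hMH
  obtain ⟨p, hp⟩ := exists_embedding_extending (by simpa using hL) f.toEmbedding
    (lastPositions hs hrn)
  refine ⟨p, ?_⟩
  rw [← hp]
  rintro _ _ ⟨hne, i, j, hij, rfl, rfl⟩
  exact ⟨hne, f i, f j, f.toHom.map_adj hij, rfl, rfl⟩

variable {D : ℕ → ℕ} {q : ℕ}

theorem le_card_filter_eq (hD : Antitone D) (hqn : r + q < n) (hq : D (r + q) = D r) :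
    q ≤ #{v ∈ (firstVertices n (r + 1))ᶜ | D v.val = D r} := by
  have hle : firstVertices n (r + 1 + q) ⊆
      firstVertices n (r + 1) ∪
        {v ∈ (firstVertices n (r + 1))ᶜ | D v = D r} := fun v hv => by
    simp only [Finset.mem_union, Finset.mem_filter, Finset.mem_compl, mem_firstVertices] at hv ⊢
    refine or_iff_not_imp_left.2 fun hvr => ⟨hvr, (hD (by omega)).antisymm ?_⟩
    exact hq.symm.trans_le (hD (by omega))
  have := (Finset.card_le_card hle).trans (Finset.card_union_le _ _)
  rw [card_firstVertices (by omega), card_firstVertices (by omega)] at this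
  omega

theorem le_add_of_card_filter_le (hD : Antitone D) {x N : ℕ}
    (hN : #{v ∈ (firstVertices n (r + 1))ᶜ | x ≤ D v.val + 1} ≤ N) {i : ℕ}
    (hi : i < n) (hx : x ≤ D i + 1) : i ≤ N + r := by
  have hle : firstVertices n (i + 1) ⊆
      firstVertices n (r + 1) ∪
        {v ∈ (firstVertices n (r + 1))ᶜ | x ≤ D v + 1} := fun v hv => by
    simp only [Finset.mem_union, Finset.mem_filter, Finset.mem_compl, mem_firstVertices] at hv ⊢
    have := hD (show v.val ≤ i by omega)
    omega
  have := (Finset.card_le_card hle).trans (Finset.card_union_le _ _)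
  by_cases hri : r < i
  · rw [card_firstVertices (by omega), card_firstVertices (by omega)] at this
    omega
  · omega

theorem add_deg_map_lastPositions_mem_Icc {M : SimpleGraph (Fin s)} {e : Fin s → ℕ}
    {hs : s ≤ r + 1} {hrn : r < n} (hMe : ∀ j, deg M j = e j) (hD : Antitone D)
    (hlow : ∀ j : Fin s, r ≤ D (r - j) + e j) (hup : ∀ j : Fin s, D (r - j) + e j ≤ r + q)
    (hrest : ∀ i, i + s ≤ r → r ≤ D i) (h0 : D 0 ≤ r + q) {t : Fin n}
    (ht : t ∈ firstVertices n (r + 1)) :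
    D t + deg (M.map (lastPositions hs hrn)) t ∈ Set.Icc r (r + q) := by
  rw [mem_firstVertices] at ht
  by_cases hts : t + s ≤ r
  · rw [deg_map_lastPositions_of_notMem M (.inl hts)]
    exact ⟨hrest t hts, (hD (Nat.zero_le t)).trans h0⟩
  · obtain ⟨j, htj⟩ : ∃ j : Fin s, t.val = r - j :=
      ⟨⟨r - t, by omega⟩, (Nat.sub_sub_self (Nat.le_of_lt_succ ht)).symm⟩
    rw [deg_map_lastPositions M j htj, hMe, htj]
    exact ⟨hlow _, hup _⟩

/-- The criterion `exists_isClique_sup` for a non-increasing sequence, when the missing edges form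
the graph `M` and the vertex `j` of `M` is put at the position `r - j`. -/
theorem hasNearClique_of_antitone {L : Type*} [Fintype L] {H : SimpleGraph L}
    {M : SimpleGraph (Fin s)} {e : Fin s → ℕ} (hMH : M ⊑ H) (hMe : ∀ j, deg M j = e j)
    (hD : Antitone D) (hL : Fintype.card L ≤ n) (hs : s ≤ r + 1) (hrn : r + 1 < n)
    (heven : Even (∑ i ∈ Finset.range n, D i)) (hqn : r + q < n) (hq : D (r + q) = D r)
    (hlow : ∀ j : Fin s, r ≤ D (r - j) + e j) (hup : ∀ j : Fin s, D (r - j) + e j ≤ r + q)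
    (hrest : ∀ i, i + s ≤ r → r ≤ D i) (h0 : D 0 ≤ r + q)
    (hsum : 2 * partialSum D (r + 1) + (∑ j, e j : ℕ) ≤ r * (r + 1) + partialSum D n)
    (hmax : ∀ x ≤ D r, ∀ N : ℕ, (∀ i < n, x ≤ D i + 1 → i ≤ N + r) →
      partialSum D (r + 1) + (∑ j, e j : ℕ) + 1 ≤ r * (r + 1) + N * (D r + 1 - x) → x + 1 ≤ N) :
    HasNearClique H (r + 1) (fun v : Fin n => D v) := by
  obtain ⟨p, hEH⟩ :=
    exists_map_lastPositions_le (hs := hs) (hrn := r.lt_succ_self.trans hrn) hMH hL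
  set E := M.map (lastPositions hs (r.lt_succ_self.trans hrn))
  set T := firstVertices n (r + 1) with hT
  have hTcard : #T = r + 1 := card_firstVertices hrn.le
  have hbound : ∀ t ∈ T, r ≤ D t + deg E t ∧ D t + deg E t ≤ r + q := fun t ht =>
    add_deg_map_lastPositions_mem_Icc hMe hD hlow hup hrest h0 ht
  have hcsum : (∑ t ∈ T, (D t + deg E t - r) : ℕ) + (r : ℤ) * (r + 1) =
      partialSum D (r + 1) + (∑ j, e j : ℕ) := by
    have h1 : ∑ t ∈ T, (D t + deg E t - r) + (r + 1) * r = ∑ t ∈ T, D t + ∑ j, e j := by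
      rw [← Finset.sum_congr rfl fun j _ => hMe j,
        ← sum_deg_map_lastPositions (hs := hs) (hrn := r.lt_succ_self.trans hrn),
        ← Finset.sum_add_distrib, ← hTcard, ← smul_eq_mul, ← Finset.sum_const,
        ← Finset.sum_add_distrib]
      exact Finset.sum_congr rfl fun t ht => Nat.sub_add_cancel (hbound t ht).1
    rw [← sum_firstVertices D hrn.le, mul_comm]
    exact_mod_cast h1
  have hDn := sum_compl_firstVertices D hrn.le
  obtain ⟨G, hG, hclique⟩ := exists_isClique_sup (d := fun v : Fin n => D v)
    (c := fun t => D t + deg E t - r) (m := D r) hTcard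
    ⟨⟨r + 1, hrn⟩, by simp [hT, mem_firstVertices]⟩
    (map_lastPositions_le_between M) (by rwa [Fin.sum_univ_eq_sum_range])
    (fun t ht => (Nat.add_sub_of_le (hbound t ht).1).symm)
    (fun v hv => hD (by
      rw [hT, Finset.mem_compl, mem_firstVertices] at hv
      omega))
    (fun t ht => (Nat.sub_le_iff_le_add'.2 (hbound t ht).2).trans (le_card_filter_eq hD hqn hq))
    (Int.ofNat_le.1 (by linarith))
    (fun x hx N hN hlt => hmax x hx N (fun i => le_add_of_card_filter_le hD hN) (by
      have hlt' := Int.ofNat_lt.2 hlt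
      rw [Nat.cast_mul, Nat.cast_sub (by omega), Nat.cast_add_one] at hlt'
      linarith))
  exact ⟨G, hG, T, hTcard, p, hclique.mono (sup_le_sup_left hEH G)⟩

end Antitone

instance : DecidableRel (SimpleGraph.pathGraph 4).Adj := fun _ _ =>
  decidable_of_iff _ SimpleGraph.pathGraph_adj.symm

instance : DecidableRel K3unionP3.Adj := fun a b => by
  unfold K3unionP3
  rcases a with a | a <;> rcases b with b | b <;> simp only [SimpleGraph.sum_adj] <;>
    infer_instance

/-- The numerical properties of a non-increasing graphic sequence of large sum whose terms, indexed
from zero, are constant from `D r` to `D (D 0 + 1)`. For `r = 3`, terms of at least 3 are excluded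
because a star then gives a near clique directly. -/
structure FlatSequence (n r : ℕ) (D : ℕ → ℕ) : Prop where
  three_le : 3 ≤ r
  le_n : 5 * r + 18 ≤ n
  le_n' : r + 42 ≤ n
  anti : Antitone D
  even : Even (∑ i ∈ Finset.range n, D i)
  erdosGallai : ∀ k ≤ n, 2 * partialSum D k ≤ (k : ℤ) * (k - 1) + partialSum D n
  le_sum : (2 * (r : ℤ) - 5) * n - r ^ 2 + 4 * r ≤ partialSum D n + 1
  flat : D r ≤ D (D 0 + 1)
  lt_n : D 0 + 1 < n
  four_le_or : 4 ≤ r ∨ D 0 ≤ 2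

namespace FlatSequence

variable {n r : ℕ} {D : ℕ → ℕ}

theorem sum_le (h : FlatSequence n r D) {a b : ℕ} (hab : a ≤ b) {y : ℤ} (hy : (D a : ℤ) ≤ y) :
    partialSum D b ≤ partialSum D a + ((b : ℤ) - a) * y :=
  partialSum_le_of_antitone h.anti hab hy

theorem sum_le_mul (h : FlatSequence n r D) (a : ℕ) {y : ℤ} (hy : (D 0 : ℤ) ≤ y) :
    partialSum D a ≤ a * y := by
  simpa [partialSum_zero] using h.sum_le a.zero_le hy

theorem le_sum_of_eq (h : FlatSequence n r D) {q : ℕ} (hqn : r + q < n) (hq : D (r + q) = D r) :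
    partialSum D (r + 1) + (q : ℤ) * D r ≤ partialSum D n := by
  have h1 := le_partialSum_of_antitone h.anti (r.le_add_right q) (y := D r) (by rw [hq])
  have h2 := partialSum_mono D (Nat.succ_le_of_lt hqn)
  have h3 := partialSum_succ D r
  push_cast at h1 h2
  linarith

theorem eq_of_le (h : FlatSequence n r D) {i : ℕ} (h1 : r ≤ i) (h2 : i ≤ D 0 + 1) : D i = D r :=
  le_antisymm (h.anti h1) (h.flat.trans (h.anti h2))

theorem eq_add_sub (h : FlatSequence n r D) : D (r + (D 0 + 1 - r)) = D r := by
  obtain hle | hlt := le_total r (D 0 + 1)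
  · exact h.eq_of_le (r.le_add_right _) (by omega)
  · rw [Nat.sub_eq_zero_of_le hlt, Nat.add_zero]

theorem eq_add_max (h : FlatSequence n r D) (h1 : D (r + 1) = D r) :
    D (r + max 1 (D 0 + 1 - r)) = D r := by
  obtain hle | hlt := le_total 1 (D 0 + 1 - r)
  · rw [max_eq_right hle, h.eq_add_sub]
  · rw [max_eq_left hlt, h1]

theorem le_succ (h : FlatSequence n r D) : r - 2 ≤ D (r + 1) := by
  have := h.le_n
  have := h.le_n'
  have := h.three_le
  by_contra hlt
  have h1 := h.erdosGallai (r + 1) (by omega)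
  have h2 := h.sum_le (show r + 1 ≤ n by omega) (y := (r : ℤ) - 3) (by omega)
  have h3 := h.le_sum
  push_cast at h1 h2
  nlinarith

theorem succ_eq (h : FlatSequence n r D) (hm : D r + 2 = r) : D (r + 1) = D r := by
  have := h.le_succ
  have := h.anti (show r ≤ r + 1 by omega)
  omega

theorem sub_one_le (h : FlatSequence n r D) (hr4 : 4 ≤ r) (hrm : r ≤ D r) :
    r - 1 ≤ D (2 * r + 1) := by
  have hn := h.le_n
  have hn' := h.le_n'
  have hS := h.le_sum
  by_contra hlt
  have hD0 : D 0 < 2 * r := by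
    by_contra hD0
    have := h.anti (show 2 * r + 1 ≤ D 0 + 1 by omega)
    have := h.flat
    omega
  have h1 := h.sum_le_mul (2 * r + 1) (y := 2 * (r : ℤ) - 1) (by omega)
  have h2 := h.sum_le (show 2 * r + 1 ≤ n by omega) (y := (r : ℤ) - 2) (by omega)
  rcases hr4.eq_or_lt with rfl | hr5
  · have he := h.even
    have h3 : partialSum D n = (∑ i ∈ Finset.range n, D i : ℕ) := by simp [partialSum]
    rw [Nat.even_iff] at he
    push_cast at h1 h2 hS
    norm_num at h1 h2 hS
    omega
  · push_cast at h1 h2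
    have h5 : (0 : ℤ) ≤ (r - 3) * (n - (5 * r + 18)) := mul_nonneg (by omega) (by omega)
    have h6 : (0 : ℤ) ≤ (r - 5) * r := mul_nonneg (by omega) (by omega)
    nlinarith

theorem le_of_count (h : FlatSequence n r D) (hr4 : 4 ≤ r) (hrm : r ≤ D r) {x N : ℕ}
    (hx : x ≤ D r) (hN : ∀ i < n, x ≤ D i + 1 → i ≤ N + r)
    (hsum : partialSum D (r + 1) + 1 ≤ r * (r + 1) + N * (D r + 1 - x)) : x + 1 ≤ N := by
  have hn := h.le_n
  have hD0 := h.anti r.zero_le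
  have h1 := hN (D 0 + 1) h.lt_n (by rw [h.eq_of_le (by omega) le_rfl]; omega)
  by_cases hxr : x ≤ r
  · have h2 := h.sub_one_le hr4 hrm
    have h3 := hN (2 * r + 1) (by omega) (by omega)
    omega
  · by_contra hxN
    have h2 := le_partialSum_of_antitone h.anti r.zero_le (y := D r) le_rfl
    rw [partialSum_zero] at h2
    obtain ⟨z, hz⟩ : ∃ z : ℤ, (D r : ℤ) = x + z - 1 := ⟨D r + 1 - x, by ring⟩
    have h3 : (N : ℤ) * z ≤ x * z := mul_le_mul_of_nonneg_right (by omega) (by omega)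
    rw [hz] at h2 hsum
    have h4 : (0 : ℤ) ≤ (x - r - 1) * (r - z) := mul_nonneg (by omega) (by omega)
    push_cast at h2
    nlinarith

theorem hasNearClique_of_le (h : FlatSequence n r D) (hrm : r ≤ D r) :
    HasNearClique K3unionP3 (r + 1) (fun v : Fin n => D v) := by
  have hn' := h.le_n'
  have hD0 := h.anti r.zero_le
  have hr4 : 4 ≤ r := by
    have := h.four_le_or
    have := h.three_le
    omega
  have hlt := h.lt_n
  refine hasNearClique_of_antitone (M := (⊥ : SimpleGraph (Fin 0))) (e := ![])
    (SimpleGraph.IsContained.of_isEmpty) nofun h.anti (by simp; omega) (by omega) (by omega)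
    h.even (by omega) h.eq_add_sub nofun nofun (fun i hi => hrm.trans (h.anti hi)) (by omega) ?_
    fun x hx N hN hsum => h.le_of_count hr4 hrm hx hN (by simpa using hsum)
  have h1 := h.erdosGallai (r + 1) (by omega)
  push_cast at h1
  simp only [Finset.univ_eq_empty, Finset.sum_empty, Nat.cast_zero]
  linarith

theorem sub_two_le (h : FlatSequence n r D) (hm : D r + 1 = r) : r - 2 ≤ D (2 * r) := by
  have hn := h.le_n
  have hr := h.three_le
  have hS := h.le_sum
  have hf := h.flat
  by_contra hlt
  have hD0 : D 0 + 1 < 2 * r := by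
    by_contra hD0
    have := h.anti (not_lt.1 hD0)
    omega
  have h1 := h.sum_le_mul (2 * r) (y := 2 * (r : ℤ) - 2) (by omega)
  have h2 := h.sum_le (show 2 * r ≤ n by omega) (y := (r : ℤ) - 3) (by omega)
  push_cast at h1 h2
  have h5 : (0 : ℤ) ≤ (r - 2) * (n - (5 * r + 18)) := mul_nonneg (by omega) (by omega)
  have h6 : (0 : ℤ) ≤ (r - 3) * r := mul_nonneg (by omega) (by omega)
  nlinarith

theorem sub_three_le (h : FlatSequence n r D) (hm : D r + 2 = r) : r - 3 ≤ D (2 * r - 1) := by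
  have hn := h.le_n
  have hr := h.three_le
  have hS := h.le_sum
  have hf := h.flat
  by_contra hlt
  have hD0 : D 0 + 2 < 2 * r := by
    by_contra hD0
    have := h.anti (show 2 * r - 1 ≤ D 0 + 1 by omega)
    omega
  have h1 := h.sum_le_mul (2 * r - 1) (y := 2 * (r : ℤ) - 3) (by omega)
  have h2 := h.sum_le (show 2 * r - 1 ≤ n by omega) (y := (r : ℤ) - 4) (by omega)
  rw [Nat.cast_sub (by omega)] at h1 h2
  push_cast at h1 h2
  have h5 : (0 : ℤ) ≤ (r - 1) * (n - (5 * r + 18)) := mul_nonneg (by omega) (by omega)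
  nlinarith

theorem hasNearClique_of_lt (h : FlatSequence n r D) (hlt : D r < r) {q s : ℕ}
    {M : SimpleGraph (Fin s)} {e : Fin s → ℕ} (hMH : M ⊑ K3unionP3) (hMe : ∀ j, deg M j = e j)
    {w : ℕ} (hw : ∑ j, e j = w) (hs : s ≤ r + 1) (hqn : r + q < n) (hq : D (r + q) = D r)
    (he : ∀ j : Fin s, r ≤ D (r - j) + e j ∧ D (r - j) + e j ≤ r + q)
    (hrest : s ≤ r → r ≤ D (r - s)) (h0 : D 0 ≤ r + q)
    (hsum : 2 * partialSum D (r + 1) + w ≤ r * (r + 1) + partialSum D n) :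
    HasNearClique K3unionP3 (r + 1) (fun v : Fin n => D v) := by
  have hn := h.le_n
  have hn' := h.le_n'
  refine hasNearClique_of_antitone hMH hMe h.anti (by simp; omega) hs (by omega) h.even hqn hq
    (fun j => (he j).1) (fun j => (he j).2)
    (fun i hi => (hrest (by omega)).trans (h.anti (by omega))) h0 (hw ▸ hsum) fun x hx N hN _ => ?_
  have h1 := h.le_succ
  have h2 := h.anti (show r ≤ r + 1 by omega)
  rcases (show D r + 1 = r ∨ D r + 2 = r by omega) with hm | hm
  · have := hN (2 * r) (by omega) (by have := h.sub_two_le hm; omega)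
    omega
  · have := hN (2 * r - 1) (by omega) (by have := h.sub_three_le hm; omega)
    omega

theorem hasNearClique_edge (h : FlatSequence n r D) (hm : D r + 1 = r) (hB : r ≤ D (r - 1)) :
    HasNearClique K3unionP3 (r + 1) (fun v : Fin n => D v) := by
  have hn := h.le_n
  have hlt := h.lt_n
  have hr := h.three_le
  have hD1 := h.anti (r - 1).zero_le
  have hD2 := h.anti (show r - 2 ≤ r - 1 by omega)
  refine h.hasNearClique_of_lt (M := (⊤ : SimpleGraph (Fin 2))) (e := ![1, 1])
    (q := D 0 + 1 - r) (w := 2) (by omega) ⟨⟨⟨![.inl 0, .inl 1], by decide⟩, by decide⟩⟩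
    (by simp only [deg_eq_card]; decide) rfl (by omega) (by omega) h.eq_add_sub
    (fun
      | 0 => (by omega : r ≤ D r + 1 ∧ D r + 1 ≤ r + (D 0 + 1 - r))
      | 1 => (by omega : r ≤ D (r - 1) + 1 ∧ D (r - 1) + 1 ≤ r + (D 0 + 1 - r)))
    (fun _ => by omega) (by omega) ?_
  have h1 := h.erdosGallai r (by omega)
  have h2 := partialSum_succ D r
  push_cast
  nlinarith

theorem hasNearClique_two_edges (h : FlatSequence n r D) (hm : D r + 1 = r)
    (hA : 4 ≤ r → r ≤ D (r - 4)) (hB : D (r - 1) + 1 = r) :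
    HasNearClique K3unionP3 (r + 1) (fun v : Fin n => D v) := by
  have hn := h.le_n
  have hlt := h.lt_n
  have hr := h.three_le
  have hD0 := h.anti (r - 3).zero_le
  have hD3 := h.anti (show r - 3 ≤ r - 2 by omega)
  have hD2 := h.anti (show r - 2 ≤ r - 1 by omega)
  refine h.hasNearClique_of_lt
    (M := SimpleGraph.fromEdgeSet ({s(0, 1), s(2, 3)} : Set (Sym2 (Fin 4))))
    (e := fun _ => 1) (q := D 0 + 1 - r) (w := 4) (by omega)
    ⟨⟨⟨![.inl 0, .inl 1, .inr 0, .inr 1], by decide⟩, by decide⟩⟩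
    (by simp only [deg_eq_card]; decide) rfl (by omega) (by omega) h.eq_add_sub
    (fun
      | 0 => (by omega : r ≤ D r + 1 ∧ D r + 1 ≤ r + (D 0 + 1 - r))
      | 1 => (by omega : r ≤ D (r - 1) + 1 ∧ D (r - 1) + 1 ≤ r + (D 0 + 1 - r))
      | 2 => (by omega : r ≤ D (r - 2) + 1 ∧ D (r - 2) + 1 ≤ r + (D 0 + 1 - r))
      | 3 => (by omega : r ≤ D (r - 3) + 1 ∧ D (r - 3) + 1 ≤ r + (D 0 + 1 - r)))
    hA (by omega) ?_
  have h1 := h.sum_le_mul (r - 1) (y := D 0) le_rfl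
  have h2 := h.sum_le (show r - 1 ≤ r + 1 by omega) (y := (r : ℤ) - 1) (by omega)
  have h3 := h.le_sum_of_eq (q := D 0 + 1 - r) (by omega) h.eq_add_sub
  have h4 : (D r : ℤ) = r - 1 := by omega
  rw [h4] at h3
  push_cast [show 1 ≤ r by omega, show r ≤ D 0 + 1 by omega] at h1 h2 h3 ⊢
  nlinarith

theorem succ_eq_of_sub_four_le (h : FlatSequence n r D) (hm : D r + 1 = r) (hr4 : 4 ≤ r)
    (hA : D (r - 4) ≤ r - 1) : D (r + 1) = D r := by
  have hn := h.le_n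
  have hS := h.le_sum
  have hlt := h.lt_n
  have := h.le_succ
  have := h.anti (show r ≤ r + 1 by omega)
  by_contra hne
  have h1 := h.sum_le_mul (r - 4) (y := (n : ℤ) - 1) (by omega)
  have h2 := h.sum_le (show r - 4 ≤ r + 1 by omega) (y := (r : ℤ) - 1) (by omega)
  have h3 := h.sum_le (show r + 1 ≤ n by omega) (y := (r : ℤ) - 2) (by omega)
  push_cast [hr4] at h1 h2 h3
  nlinarith

theorem le_sub_five (h : FlatSequence n r D) (hr5 : 5 ≤ r) : r ≤ D (r - 5) := by
  have hn := h.le_n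
  have hS := h.le_sum
  have hlt := h.lt_n
  by_contra hne
  have h1 := h.sum_le_mul (r - 5) (y := (n : ℤ) - 1) (by omega)
  have h2 := h.sum_le (show r - 5 ≤ n by omega) (y := (r : ℤ) - 1) (by omega)
  push_cast [hr5] at h1 h2
  nlinarith

theorem hasNearClique_triangle_edge (h : FlatSequence n r D) (hm : D r + 1 = r) (hr4 : 4 ≤ r)
    (hA : D (r - 4) ≤ r - 1) : HasNearClique K3unionP3 (r + 1) (fun v : Fin n => D v) := by
  have hn := h.le_n
  have hlt := h.lt_n
  have hr1 := h.succ_eq_of_sub_four_le hm hr4 hA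
  have hmid : ∀ j ≤ 4, D (r - j) + 1 = r := fun j hj => by
    have := h.anti (show r - 4 ≤ r - j by omega)
    have := h.anti (show r - j ≤ r by omega)
    omega
  set q := max 1 (D 0 + 1 - r)
  refine h.hasNearClique_of_lt
    (M := SimpleGraph.fromEdgeSet
      ({s(0, 1), s(2, 3), s(2, 4), s(3, 4)} : Set (Sym2 (Fin 5))))
    (e := ![1, 1, 2, 2, 2]) (q := q) (w := 8) (by omega)
    ⟨⟨⟨![.inr 0, .inr 1, .inl 0, .inl 1, .inl 2], by decide⟩, by decide⟩⟩
    (by simp only [deg_eq_card]; decide) rfl (by omega) (by omega) (h.eq_add_max hr1)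
    (fun j => ?_) h.le_sub_five (by omega) ?_
  · have hj := hmid j (by omega)
    have he : ∀ j : Fin 5, 1 ≤ ![1, 1, 2, 2, 2] j ∧ ![1, 1, 2, 2, 2] j ≤ 2 := by decide
    have := he j
    omega
  · have h1 := h.sum_le_mul (r - 4) (y := D 0) le_rfl
    have h2 := h.sum_le (show r - 4 ≤ r + 1 by omega) (y := (r : ℤ) - 1) (by omega)
    have h3 := h.le_sum_of_eq (q := q) (by omega) (h.eq_add_max hr1)
    have h4 : (D r : ℤ) = r - 1 := by omega
    rw [h4] at h3
    have h5 : (0 : ℤ) ≤ (r - 4) * (q - (D 0 - r)) := mul_nonneg (by omega) (by omega)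
    have h6 : (1 : ℤ) ≤ q := by omega
    push_cast [hr4] at h1 h2 h3 ⊢
    nlinarith

theorem hasNearClique_triangle (h : FlatSequence n r D) (hm : D r + 2 = r)
    (hA : D (r - 2) ≤ r - 2) : HasNearClique K3unionP3 (r + 1) (fun v : Fin n => D v) := by
  have hn' := h.le_n'
  have hlt := h.lt_n
  have hr := h.three_le
  have hS := h.le_sum
  have hr1 := h.succ_eq hm
  have hB : r ≤ D (r - 3) := by
    by_contra hne
    have h1 := h.sum_le_mul (r - 3) (y := (n : ℤ) - 2) (by omega)
    have h2 := h.sum_le (show r - 3 ≤ r - 2 by omega) (y := (r : ℤ) - 1) (by omega)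
    have h3 := h.sum_le (show r - 2 ≤ n by omega) (y := (r : ℤ) - 2) (by omega)
    push_cast [hr, show 2 ≤ r by omega] at h1 h2 h3
    nlinarith
  have hmid : ∀ j ≤ 2, D (r - j) + 2 = r := fun j hj => by
    have := h.anti (show r - 2 ≤ r - j by omega)
    have := h.anti (show r - j ≤ r by omega)
    omega
  set q := max 1 (D 0 + 1 - r)
  refine h.hasNearClique_of_lt (M := (⊤ : SimpleGraph (Fin 3))) (e := fun _ => 2) (q := q)
    (w := 6) (by omega) ⟨⟨⟨![.inl 0, .inl 1, .inl 2], by decide⟩, by decide⟩⟩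
    (by simp only [deg_eq_card]; decide) rfl (by omega) (by omega) (h.eq_add_max hr1)
    (fun j => ?_) (fun _ => hB) (by omega) ?_
  · have := hmid j (by omega)
    omega
  · have h1 := h.sum_le_mul (r - 2) (y := D 0) le_rfl
    have h2 := h.sum_le (show r - 2 ≤ r + 1 by omega) (y := (r : ℤ) - 2) (by omega)
    have h3 := h.le_sum_of_eq (q := q) (by omega) (h.eq_add_max hr1)
    have h4 : (D r : ℤ) = r - 2 := by omega
    rw [h4] at h3
    have h5 : (0 : ℤ) ≤ (r - 2) * (q - (D 0 - r)) := mul_nonneg (by omega) (by omega)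
    push_cast [show 2 ≤ r by omega] at h1 h2 h3 ⊢
    nlinarith

theorem le_sub_four (h : FlatSequence n r D) (hm : D r + 2 = r) (hr4 : 4 ≤ r) :
    r ≤ D (r - 4) := by
  have hn' := h.le_n'
  have hlt := h.lt_n
  have hS := h.le_sum
  by_contra hne
  have h1 := h.sum_le_mul (r - 4) (y := (n : ℤ) - 1) (by omega)
  have h2 := h.sum_le (show r - 4 ≤ r by omega) (y := (r : ℤ) - 1) (by omega)
  have h3 := h.sum_le (show r ≤ n by omega) (y := (r : ℤ) - 2) (by omega)
  push_cast [hr4] at h1 h2 h3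
  nlinarith

theorem hasNearClique_path (h : FlatSequence n r D) (hm : D r + 2 = r)
    (hA : r - 1 ≤ D (r - 2)) (hB : D (r - 1) ≤ r - 1)
    (hC : D (r - 1) ≤ r - 2 ∨ D (r - 3) ≤ r - 1) :
    HasNearClique K3unionP3 (r + 1) (fun v : Fin n => D v) := by
  have hn' := h.le_n'
  have hlt := h.lt_n
  have hr := h.three_le
  have hr1 := h.succ_eq hm
  have hD0 := h.anti (r - 3).zero_le
  have hD3 := h.anti (show r - 3 ≤ r - 2 by omega)
  have hD1 := h.anti (show r - 1 ≤ r by omega)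
  set q := max 1 (D 0 + 1 - r)
  refine h.hasNearClique_of_lt
    (M := SimpleGraph.fromEdgeSet ({s(0, 1), s(0, 3), s(1, 2)} : Set (Sym2 (Fin 4))))
    (e := ![2, 2, 1, 1]) (q := q) (w := 6) (by omega)
    ⟨⟨⟨![.inr 1, .inr 2, .inr 3, .inr 0], by decide⟩, by decide⟩⟩
    (by simp only [deg_eq_card]; decide) rfl (by omega) (by omega) (h.eq_add_max hr1)
    (fun
      | 0 => (by omega : r ≤ D r + 2 ∧ D r + 2 ≤ r + q)
      | 1 => (by omega : r ≤ D (r - 1) + 2 ∧ D (r - 1) + 2 ≤ r + q)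
      | 2 => (by omega : r ≤ D (r - 2) + 1 ∧ D (r - 2) + 1 ≤ r + q)
      | 3 => (by omega : r ≤ D (r - 3) + 1 ∧ D (r - 3) + 1 ≤ r + q))
    (h.le_sub_four hm) (by omega) ?_
  rcases hC with hC | hC
  · have h1 := h.erdosGallai (r - 1) (by omega)
    have h2 := h.sum_le (show r - 1 ≤ r + 1 by omega) (y := (r : ℤ) - 2) (by omega)
    push_cast [show 1 ≤ r by omega] at h1 h2 ⊢
    nlinarith
  · have h1 := h.sum_le_mul (r - 3) (y := D 0) le_rfl
    have h2 := h.sum_le (show r - 3 ≤ r by omega) (y := (r : ℤ) - 1) (by omega)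
    have h3 := partialSum_succ D r
    have h4 := h.le_sum_of_eq (q := q) (by omega) (h.eq_add_max hr1)
    have h5 : (D r : ℤ) = r - 2 := by omega
    rw [h5] at h3 h4
    have h6 : (0 : ℤ) ≤ (r - 3) * (q - (D 0 - r)) := mul_nonneg (by omega) (by omega)
    have h7 : (1 : ℤ) ≤ q := by omega
    push_cast [hr] at h1 h2 h4 ⊢
    nlinarith

theorem hasNearClique_cherry (h : FlatSequence n r D) (hm : D r + 2 = r)
    (hA : r ≤ D (r - 3)) (hB : r - 1 ≤ D (r - 1)) :
    HasNearClique K3unionP3 (r + 1) (fun v : Fin n => D v) := by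
  have hn' := h.le_n'
  have hlt := h.lt_n
  have hr := h.three_le
  have hr1 := h.succ_eq hm
  have hD0 := h.anti (r - 2).zero_le
  have hD2 := h.anti (show r - 2 ≤ r - 1 by omega)
  set q := max 1 (D 0 + 1 - r)
  refine h.hasNearClique_of_lt
    (M := SimpleGraph.fromEdgeSet ({s(0, 1), s(0, 2)} : Set (Sym2 (Fin 3))))
    (e := ![2, 1, 1]) (q := q) (w := 4) (by omega)
    ⟨⟨⟨![.inr 1, .inr 0, .inr 2], by decide⟩, by decide⟩⟩
    (by simp only [deg_eq_card]; decide) rfl (by omega) (by omega) (h.eq_add_max hr1)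
    (fun
      | 0 => (by omega : r ≤ D r + 2 ∧ D r + 2 ≤ r + q)
      | 1 => (by omega : r ≤ D (r - 1) + 1 ∧ D (r - 1) + 1 ≤ r + q)
      | 2 => (by omega : r ≤ D (r - 2) + 1 ∧ D (r - 2) + 1 ≤ r + q))
    (fun _ => hA) (by omega) ?_
  have h1 := h.erdosGallai r (by omega)
  have h2 := partialSum_succ D r
  push_cast
  nlinarith

theorem hasNearClique (h : FlatSequence n r D) :
    HasNearClique K3unionP3 (r + 1) (fun v : Fin n => D v) := by
  have hr := h.three_le
  have h1 := h.le_succ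
  have h2 := h.anti (show r ≤ r + 1 by omega)
  have h3 := h.anti (show r - 1 ≤ r by omega)
  rcases (show r ≤ D r ∨ D r + 1 = r ∨ D r + 2 = r by omega) with hm | hm | hm
  · exact h.hasNearClique_of_le hm
  · by_cases hA : 4 ≤ r ∧ D (r - 4) ≤ r - 1
    · exact h.hasNearClique_triangle_edge hm hA.1 hA.2
    · by_cases hB : D (r - 1) ≤ r - 1
      · exact h.hasNearClique_two_edges hm (by omega) (by omega)
      · exact h.hasNearClique_edge hm (by omega)
  · have h4 := h.anti (show r - 2 ≤ r - 1 by omega)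
    by_cases hA : D (r - 2) ≤ r - 2
    · exact h.hasNearClique_triangle hm hA
    · by_cases hB : D (r - 1) ≤ r - 2 ∨ D (r - 3) ≤ r - 1
      · have h5 := h.anti (show r - 3 ≤ r - 1 by omega)
        exact h.hasNearClique_path hm (by omega) (by omega) hB
      · exact h.hasNearClique_cherry hm (by omega) (by omega)

end FlatSequence

section VertexRemoval

variable {V : Type*} {u : V}

theorem deg_map_val_sup_starGraph [Finite V] (G : SimpleGraph {v // v ≠ u}) (A : Finset V) (v : V) :
    deg (G.map Subtype.val ⊔ starGraph u A) v =
      deg (G.map Subtype.val) v + deg (starGraph u A) v := by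
  refine deg_sup (SimpleGraph.disjoint_left.2 fun a b hab h => ?_) v
  obtain ⟨-, x, y, -, rfl, rfl⟩ := hab
  rcases (starGraph_adj.1 h).2 with ⟨h, -⟩ | ⟨-, h⟩
  exacts [x.2 h, y.2 h]

variable (K : SimpleGraph V)

theorem map_comap_val_sup_starGraph [Fintype V] [DecidableRel K.Adj] (u : V) :
    (K.comap Subtype.val).map (Subtype.val : {v // v ≠ u} → V) ⊔
      starGraph u {w | K.Adj u w} = K := by
  ext a b
  simp only [SimpleGraph.sup_adj, SimpleGraph.map_adj', starGraph_adj, SimpleGraph.comap_adj,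
    Subtype.exists, Finset.mem_filter_univ]
  grind [K.adj_comm, K.ne_of_adj]

theorem deg_eq_deg_comap_val_add [Finite V] [DecidableRel K.Adj] (w : {v // v ≠ u}) :
    deg K w = deg (K.comap Subtype.val) w + if K.Adj u w then 1 else 0 := by
  classical
  cases nonempty_fintype V
  conv_lhs => rw [← map_comap_val_sup_starGraph K u]
  rw [deg_map_val_sup_starGraph, deg_starGraph (by simp), if_neg w.2]
  congr 1
  · exact deg_map (.subtype _) _ w
  · simp only [Finset.mem_filter_univ]

theorem sum_deg_eq_sum_deg_comap_val_add [Fintype V] [DecidableEq V] (u : V) :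
    ∑ v, deg K v = ∑ w : {v // v ≠ u}, deg (K.comap Subtype.val) w + 2 * deg K u := by
  classical
  have hu : deg K u = ∑ w : {v // v ≠ u}, if K.Adj u w then 1 else 0 := by
    rw [deg_eq_card, Finset.card_filter, Fintype.sum_eq_add_sum_subtype_ne _ u, if_neg K.irrefl,
      zero_add]
  rw [Fintype.sum_eq_add_sum_subtype_ne _ u,
    Finset.sum_congr rfl fun w _ => deg_eq_deg_comap_val_add K w, Finset.sum_add_distrib, ← hu]
  omega

variable {K} [Finite V] {L : Type*} {H : SimpleGraph L}

theorem exists_deg_eq_of_deg_comap_val {G : SimpleGraph {v // v ≠ u}}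
    (hG : ∀ w, deg G w = deg (K.comap Subtype.val) w) :
    ∃ G' : SimpleGraph V, (∀ v, deg G' v = deg K v) ∧ G.map Subtype.val ≤ G' ∧
      ∀ v, K.Adj u v → G'.Adj u v := by
  classical
  cases nonempty_fintype V
  refine ⟨G.map Subtype.val ⊔ starGraph u {w | K.Adj u w}, fun v => ?_, le_sup_left,
    fun v huv => Or.inr (starGraph_adj.2 ⟨huv.ne, by simp [huv]⟩)⟩
  conv_rhs => rw [← map_comap_val_sup_starGraph K u]
  rw [deg_map_val_sup_starGraph, deg_map_val_sup_starGraph]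
  congr 1
  by_cases hv : v = u
  · have hv' : v ∉ Set.range (Function.Embedding.subtype (· ≠ u)) := by simp [hv]
    exact (deg_map_of_notMem_range _ hv').trans (deg_map_of_notMem_range _ hv').symm
  · exact (deg_map (.subtype _) G ⟨v, hv⟩).trans
      ((hG ⟨v, hv⟩).trans (deg_map (.subtype _) _ ⟨v, hv⟩).symm)

theorem HasNearClique.succ_of_adj {m : ℕ} {X : Finset {v // v ≠ u}} (hm : m ≤ #X)
    (hadj : ∀ x ∈ X, K.Adj u x)
    (hX : ∀ x ∈ X, ∀ z ∉ X, deg (K.comap Subtype.val) z ≤ deg (K.comap Subtype.val) x)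
    (h : HasNearClique H m fun w : {v // v ≠ u} => deg (K.comap Subtype.val) w) :
    HasNearClique H (m + 1) (deg K) := by
  classical
  obtain ⟨G, hG, T, hT, p, hp⟩ := h
  obtain ⟨Y, hYX, hY, hYtop⟩ := exists_subset_card_eq_of_largest (deg G) hm
  obtain ⟨G₁, hG₁, q, hq⟩ := exists_isClique_of_top_deg (hT.trans hY.symm) (fun y hy z hz => by
    by_cases hzX : z ∈ X
    · exact hYtop y hy z hzX hz
    · simpa only [hG] using hX y (hYX hy) z hzX) hp
  obtain ⟨G₂, hG₂, hle, hu⟩ := exists_deg_eq_of_deg_comap_val fun w => (hG₁ w).trans (hG w)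
  refine ⟨G₂, hG₂, insert u (Y.map (.subtype _)), ?_, q.trans (.subtype _), ?_⟩
  · rw [Finset.card_insert_of_notMem (by simp), Finset.card_map, hY]
  · rw [Finset.coe_insert, SimpleGraph.isClique_insert, Finset.coe_map]
    refine ⟨?_, ?_⟩
    · rintro _ ⟨a, ha, rfl⟩ _ ⟨b, hb, rfl⟩ hab
      rcases hq ha hb (fun h => hab (congrArg _ h)) with h | h
      · exact Or.inl (hle ⟨hab, a, b, h, rfl, rfl⟩)
      · obtain ⟨i, j, hij, rfl, rfl⟩ := (SimpleGraph.map_adj _ _ _ _).1 h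
        exact Or.inr ((SimpleGraph.map_adj _ _ _ _).2 ⟨i, j, hij, rfl, rfl⟩)
    · rintro _ ⟨a, ha, rfl⟩ -
      exact Or.inl (hu _ (hadj a (hYX ha)))

end VertexRemoval

section Induction

variable {V : Type*} [Fintype V] {G : SimpleGraph V}

theorem hasNearClique_of_triple {A T : Finset V} {m : ℕ} (hA : #A = 3) (hT : #T = m)
    (hV : 7 ≤ Fintype.card V) (hG : ∀ a ∈ T, ∀ b ∈ T, a ≠ b → ¬ (a ∈ A ∧ b ∈ A) → G.Adj a b) :
    HasNearClique K3unionP3 m (deg G) := by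
  classical
  obtain ⟨B, hBA, hB⟩ := Finset.exists_subset_card_eq (s := Aᶜ) (n := 4) (by
    rw [Finset.card_compl]
    omega)
  let f : Fin 3 ≃ A := (A.equivFinOfCardEq hA).symm
  let g : Fin 4 ≃ B := (B.equivFinOfCardEq hB).symm
  let p : Fin 3 ⊕ Fin 4 ↪ V := ⟨Sum.elim (fun i => f i) fun j => g j,
    (Subtype.val_injective.comp f.injective).sumElim (Subtype.val_injective.comp g.injective)
      fun i j h => Finset.mem_compl.1 (hBA (g j).2) (by
        rw [← show (f i : V) = g j from h]
        exact (f i).2)⟩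
  refine ⟨G, fun _ => rfl, T, hT, p, fun a ha b hb hab => ?_⟩
  by_cases h : a ∈ A ∧ b ∈ A
  · refine Or.inr ((SimpleGraph.map_adj _ _ _ _).2
      ⟨.inl (f.symm ⟨a, h.1⟩), .inl (f.symm ⟨b, h.2⟩), ?_, by simp [p], by simp [p]⟩)
    simp [K3unionP3, hab]
  · exact Or.inl (hG a ha b hb hab h)

theorem hasNearClique_four_of_three_le_deg {u : V} (hu : 3 ≤ deg G u) (hV : 7 ≤ Fintype.card V) :
    HasNearClique K3unionP3 4 (deg G) := by
  classical
  rw [deg_eq_card] at hu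
  obtain ⟨A, hAu, hA⟩ := Finset.exists_subset_card_eq hu
  have hadj : ∀ a ∈ A, G.Adj u a := fun a ha => (Finset.mem_filter.1 (hAu ha)).2
  have huA : u ∉ A := fun h => G.irrefl (hadj u h)
  have huA4 : #(insert u A) = 4 := by rw [Finset.card_insert_of_notMem huA, hA]
  refine hasNearClique_of_triple hA huA4 hV fun a ha b hb hab h => ?_
  grind [G.adj_comm]

theorem exists_antitone_rearrangement (d : V → ℕ) :
    ∃ (D : ℕ → ℕ) (e : V ≃ Fin (Fintype.card V)), Antitone D ∧ ∀ v, d v = D (e v) := by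
  let e := Fintype.equivFin V
  let d' : Fin (Fintype.card V) → ℕᵒᵈ := fun i => OrderDual.toDual (d (e.symm i))
  have hd' : Monotone (d' ∘ Tuple.sort d') := Tuple.monotone_sort d'
  refine ⟨fun i => if h : i < Fintype.card V then d (e.symm (Tuple.sort d' ⟨i, h⟩)) else 0,
    e.trans (Tuple.sort d').symm, fun i j hij => ?_, fun v => by simp⟩
  dsimp only
  split_ifs with hj hi
  · exact hd' (show (⟨i, hi⟩ : Fin (Fintype.card V)) ≤ ⟨j, hj⟩ from hij)
  · omega
  · exact Nat.zero_le _
  · exact le_rfl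

variable {D : ℕ → ℕ} {e : V ≃ Fin (Fintype.card V)}

theorem hasNearClique_of_flat {r : ℕ} (hr : 3 ≤ r) (hn : 5 * r + 18 ≤ Fintype.card V)
    (hn' : r + 42 ≤ Fintype.card V)
    (hsum : (2 * (r : ℤ) - 5) * Fintype.card V - r ^ 2 + 4 * r ≤ (∑ v, deg G v : ℕ) + 1)
    (hD : Antitone D) (he : ∀ v, deg G v = D (e v)) (hflat : D r ≤ D (D 0 + 1))
    (hlt : D 0 + 1 < Fintype.card V) (hor : 4 ≤ r ∨ D 0 ≤ 2) :
    HasNearClique K3unionP3 (r + 1) (deg G) := by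
  have hsumD : ∑ v, deg G v = ∑ i ∈ Finset.range (Fintype.card V), D i := by
    rw [← Fin.sum_univ_eq_sum_range, ← Equiv.sum_comp e]
    exact Finset.sum_congr rfl fun v _ => he v
  have hcomap : ∀ i, deg (G.comap e.symm) i = D i := fun i => by
    rw [deg_comap_equiv, he, Equiv.apply_symm_apply]
  have h : FlatSequence (Fintype.card V) r D :=
    { three_le := hr
      le_n := hn
      le_n' := hn'
      anti := hD
      even := hsumD ▸ even_sum_deg G
      erdosGallai := fun k hk => two_mul_partialSum_le hcomap hk
      le_sum := by
        rw [hsumD] at hsum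
        simpa [partialSum] using hsum
      flat := hflat
      lt_n := hlt
      four_le_or := hor }
  exact funext he ▸ h.hasNearClique.comp_equiv e

open Classical in
/-- `u` is a vertex of maximal degree and `X` consists of the other vertices of degree at least
`D m`; as `D` is not flat, there are at most `D 0` of them. -/
theorem exists_adj_of_not_flat {m : ℕ} (hm : m + 1 ≤ Fintype.card V) (hD : Antitone D)
    (he : ∀ v, deg G v = D (e v))
    (hflat : ¬ (D 0 + 1 < Fintype.card V ∧ D m ≤ D (D 0 + 1))) :
    ∃ (u : V) (K : SimpleGraph V), (∀ v, deg K v = deg G v) ∧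
      ∃ X : Finset {v // v ≠ u}, m ≤ #X ∧ (∀ x ∈ X, K.Adj u x) ∧
        ∀ x ∈ X, ∀ z ∉ X, deg (K.comap Subtype.val) z ≤ deg (K.comap Subtype.val) x := by
  set u := e.symm ⟨0, by omega⟩
  have hu : deg G u = D 0 := by simp [he, u]
  set Y : Finset V := {v | D m ≤ deg G v}
  have huY : u ∈ Y := by simpa [Y, hu] using hD (Nat.zero_le m)
  have le_card : m + 1 ≤ #Y := by
    rw [← card_firstVertices hm, ← Finset.card_map e.toEmbedding]
    refine Finset.card_le_card fun i hi => Finset.mem_map_equiv.2 ?_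
    simpa [Y, he] using hD (Nat.le_of_lt_succ (mem_firstVertices.1 hi))
  have card_le : #Y ≤ D 0 + 1 := by
    rcases lt_or_ge (D 0 + 1) (Fintype.card V) with h | h
    · rw [← card_firstVertices h.le, ← Finset.card_map e.toEmbedding]
      refine Finset.card_le_card fun i hi => mem_firstVertices.2 ?_
      by_contra! hge
      have hi : D m ≤ D i := by simpa [Y, he] using hi
      exact hflat ⟨h, hi.trans (hD hge)⟩
    · exact (Finset.card_le_univ Y).trans h
  have hYu : #(Y.erase u) + 1 = #Y := Finset.card_erase_add_one huY
  obtain ⟨K, hK, hadj⟩ := exists_adj_top (Finset.notMem_erase u Y) (G := G) (by omega)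
    fun x hx y hy hyu => by
      simp only [Y, Finset.mem_erase, Finset.mem_filter_univ] at hx hy
      grind
  refine ⟨u, K, hK, (Y.erase u).subtype _, ?_, fun x hx => hadj x (Finset.mem_subtype.1 hx),
    fun x hx z hz => ?_⟩
  · rw [Finset.card_subtype, Finset.filter_true_of_mem fun x hx => Finset.ne_of_mem_erase hx]
    omega
  · have hux := hadj x (Finset.mem_subtype.1 hx)
    have h1 := deg_eq_deg_comap_val_add K x
    have h2 := deg_eq_deg_comap_val_add K z
    rw [hK, if_pos hux] at h1
    rw [hK] at h2
    have hx : D m ≤ deg G x := by simpa [Y, x.2] using hx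
    have hz : deg G z < D m := by simpa [Y, z.2] using hz
    omega

theorem hasNearClique_of_le_sum_deg {r : ℕ} (hr : 2 ≤ r) {V : Type*} [Fintype V]
    (G : SimpleGraph V) (hn : 5 * r + 18 ≤ Fintype.card V) (hn' : r + 42 ≤ Fintype.card V)
    (hsum : (2 * (r : ℤ) - 5) * Fintype.card V - r ^ 2 + 4 * r ≤ (∑ v, deg G v : ℕ) + 1) :
    HasNearClique K3unionP3 (r + 1) (deg G) := by
  classical
  induction r, hr using Nat.le_induction generalizing V with
  | base =>
    obtain ⟨A, -, hA⟩ := Finset.exists_subset_card_eq (s := (Finset.univ : Finset V)) (n := 3)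
      (by rw [Finset.card_univ]; omega)
    exact hasNearClique_of_triple hA hA (by omega) fun a ha b hb _ h => absurd ⟨ha, hb⟩ h
  | succ r hr ih =>
    obtain ⟨D, e, hD, he⟩ := exists_antitone_rearrangement (deg G)
    have hu : deg G (e.symm ⟨0, by omega⟩) = D 0 := by simp [he]
    by_cases hstar : r + 1 = 3 ∧ 3 ≤ D 0
    · rw [hstar.1]
      exact hasNearClique_four_of_three_le_deg (hu ▸ hstar.2) (by omega)
    by_cases hflat : D 0 + 1 < Fintype.card V ∧ D (r + 1) ≤ D (D 0 + 1)
    · exact hasNearClique_of_flat (by omega) hn hn' hsum hD he hflat.2 hflat.1 (by omega)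
    obtain ⟨u, K, hK, X, hX, hadj, htop⟩ := exists_adj_of_not_flat (by omega) hD he hflat
    have hcard : Fintype.card {v // v ≠ u} + 1 = Fintype.card V := by
      rw [Fintype.card_subtype_compl, Fintype.card_subtype_eq]
      omega
    have hsumK := sum_deg_eq_sum_deg_comap_val_add K u
    have hlt := deg_lt_card K u
    rw [← funext hK] at hsum ⊢
    refine HasNearClique.succ_of_adj hX hadj htop (ih _ (by omega) (by omega) ?_)
    rw [hsumK, ← hcard] at hsum
    push_cast at hsum ⊢
    have : (deg K u : ℤ) ≤ Fintype.card {v // v ≠ u} := by omega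
    linarith

end Induction

section FourVertices

variable {V : Type*} {G : SimpleGraph V} {a b c d : V}

theorem Z4_adj {i j : Fin 4} : Z4.Adj i j ↔ i ≠ j ∧ s(i, j) ≠ s(0, 1) ∧ s(i, j) ≠ s(1, 2) := by
  simp only [Z4, completeMinus, SimpleGraph.compl_adj, SimpleGraph.map_adj,
    SimpleGraph.pathGraph_adj, Fin.castLEEmb_apply]
  revert i j
  decide

theorem Z4_isContained_of_adj (hab : a ≠ b) (hbc : b ≠ c) (hac : G.Adj a c) (had : G.Adj a d)
    (hbd : G.Adj b d) (hcd : G.Adj c d) : Z4 ⊑ G := by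
  refine ⟨⟨⟨![a, b, c, d], fun {i j} hij => ?_⟩, fun i j hij => ?_⟩⟩
  · rw [Z4_adj] at hij
    fin_cases i <;> fin_cases j <;> simp_all [G.adj_comm]
  · have := hac.ne
    have := had.ne
    have := hbd.ne
    have := hcd.ne
    fin_cases i <;> fin_cases j <;> simp_all

theorem cycleGraph_isContained_of_adj (hac : a ≠ c) (hbd : b ≠ d) (hab : G.Adj a b)
    (hbc : G.Adj b c) (hcd : G.Adj c d) (hda : G.Adj d a) : SimpleGraph.cycleGraph 4 ⊑ G := by
  refine ⟨⟨⟨![a, b, c, d], fun {i j} hij => ?_⟩, fun i j hij => ?_⟩⟩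
  · rw [SimpleGraph.cycleGraph_adj] at hij
    have : (-2 : Fin 4) ≠ 1 := by decide
    fin_cases i <;> fin_cases j <;> simp_all [G.adj_comm]
  · have := hab.ne
    have := hbc.ne
    have := hcd.ne
    have := hda.ne
    fin_cases i <;> fin_cases j <;> simp_all

variable [Fintype V] {H : SimpleGraph V}

theorem Z4_isContained_compl (hV : Fintype.card V = 4) (hH : H.edgeSet.ncard ≤ 2)
    (hbc : b ≠ c) (hab : H.Adj a b) (hac : H.Adj a c) : Z4 ⊑ Hᶜ := by
  classical
  obtain ⟨d, hd⟩ : ∃ d, d ∉ ({a, b, c} : Finset V) := by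
    by_contra! h
    have := Finset.card_le_three (a := a) (b := b) (c := c)
    rw [Finset.eq_univ_of_forall h, Finset.card_univ] at this
    omega
  have edges : ({s(a, b), s(a, c)} : Set (Sym2 V)) = H.edgeSet := by
    refine Set.eq_of_subset_of_ncard_le (Set.insert_subset hab (Set.singleton_subset_iff.2 hac))
      (hH.trans_eq (Set.ncard_pair ?_).symm) (Set.toFinite _)
    simp [hbc, hac.ne]
  have hadj : ∀ x y, H.Adj x y → s(x, y) = s(a, b) ∨ s(x, y) = s(a, c) := fun x y h => by
    simpa [← edges] using (SimpleGraph.mem_edgeSet H).2 h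
  have := hab.ne
  have := hac.ne
  simp only [Finset.mem_insert, Finset.mem_singleton, not_or] at hd
  refine Z4_isContained_of_adj (a := b) (b := a) (c := c) (d := d) hab.ne' hac.ne ?_ ?_ ?_ ?_ <;>
    · rw [SimpleGraph.compl_adj]
      grind

theorem cycleGraph_isContained_compl (hV : Fintype.card V = 4)
    (hH : ∀ a b c, H.Adj a b → H.Adj a c → b = c) : SimpleGraph.cycleGraph 4 ⊑ Hᶜ := by
  classical
  obtain ⟨a, c, hac, h⟩ : ∃ a c, a ≠ c ∧ (H.Adj a c ∨ H = ⊥) := by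
    rcases eq_or_ne H ⊥ with h | h
    · obtain ⟨a, c, hac⟩ := Fintype.one_lt_card_iff.1 (show 1 < Fintype.card V by omega)
      exact ⟨a, c, hac, Or.inr h⟩
    · obtain ⟨a, c, hac⟩ := SimpleGraph.ne_bot_iff_exists_adj.1 h
      exact ⟨a, c, hac.ne, Or.inl hac⟩
  obtain ⟨b, d, hbd, hcompl⟩ := Finset.card_eq_two.1
    (show #({a, c}ᶜ : Finset V) = 2 by rw [Finset.card_compl, Finset.card_pair hac, hV])
  have hout : ∀ x, (x = b ∨ x = d) → x ≠ a ∧ x ≠ c := fun x hx => by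
    have : x ∈ ({a, c}ᶜ : Finset V) := by simpa [hcompl] using hx
    simpa using this
  have key : ∀ x, (x = b ∨ x = d) → Hᶜ.Adj a x ∧ Hᶜ.Adj x c := fun x hx => by
    obtain ⟨hxa, hxc⟩ := hout x hx
    simp only [SimpleGraph.compl_adj]
    rcases h with h | rfl
    · refine ⟨⟨hxa.symm, fun hx => hxc (hH a x c hx h)⟩, hxc, fun hx => hxa ?_⟩
      exact hH c x a hx.symm h.symm
    · simp [hxa.symm, hxc]
  obtain ⟨hab, hbc⟩ := key b (Or.inl rfl)
  obtain ⟨had, hdc⟩ := key d (Or.inr rfl)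
  exact cycleGraph_isContained_of_adj hac hbd hab hbc hdc.symm had.symm

theorem cycleGraph_or_Z4_isContained_compl (hV : Fintype.card V = 4)
    (hH : H.edgeSet.ncard ≤ 2) : SimpleGraph.cycleGraph 4 ⊑ Hᶜ ∨ Z4 ⊑ Hᶜ := by
  by_cases hpath : ∃ a b c, H.Adj a b ∧ H.Adj a c ∧ b ≠ c
  · obtain ⟨a, b, c, hab, hac, hbc⟩ := hpath
    exact Or.inr (Z4_isContained_compl hV hH hbc hab hac)
  · push Not at hpath
    exact Or.inl (cycleGraph_isContained_compl hV hpath)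

end FourVertices

section Obstruction

theorem isContained_of_isContained_map {L V W : Type*} {H : SimpleGraph L} {U : SimpleGraph V}
    {f : V ↪ W} (hH : ∀ v, ∃ w, H.Adj v w) (h : H ⊑ U.map f) : H ⊑ U := by
  obtain ⟨φ⟩ := h
  have hrange : ∀ v, ∃ x, f x = φ v := fun v => by
    obtain ⟨w, hw⟩ := hH v
    obtain ⟨x, -, -, hx, -⟩ := (SimpleGraph.map_adj _ _ _ _).1 (φ.toHom.map_adj hw)
    exact ⟨x, hx⟩
  choose g hg using hrange
  refine ⟨⟨⟨g, fun {a b} hab => ?_⟩, fun a b hab => φ.injective ?_⟩⟩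
  · have := φ.toHom.map_adj hab
    rwa [SimpleGraph.Copy.coe_toHom, ← hg, ← hg, SimpleGraph.map_adj_apply] at this
  · rw [SimpleGraph.Copy.coe_toHom, ← hg, ← hg]
    exact congrArg f hab

theorem two_lt_ncard_edgeSet_of_compl_isContained_map {V K W : Type*} [Fintype V]
    {H : SimpleGraph V} {U : SimpleGraph K} {f : K ↪ W} (hV : Fintype.card V = 4)
    (hHU : Hᶜ ⊑ U.map f) (hC4 : ¬ SimpleGraph.cycleGraph 4 ⊑ U) (hZ4 : ¬ Z4 ⊑ U) :
    2 < H.edgeSet.ncard := by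
  by_contra! hH
  rcases cycleGraph_or_Z4_isContained_compl hV hH with h | h
  · refine hC4 (isContained_of_isContained_map ?_ (h.trans hHU))
    simp only [SimpleGraph.cycleGraph_adj]
    decide
  · refine hZ4 (isContained_of_isContained_map ?_ (h.trans hHU))
    simp only [Z4_adj]
    decide

variable {V K L : Type*} [Fintype V] {G : SimpleGraph V} {A : Finset V}

theorem adj_of_deg_add_one_eq_card {v w : V} (hv : deg G v + 1 = Fintype.card V) (hvw : v ≠ w) :
    G.Adj v w := by
  classical
  rw [deg_eq_card, ← Finset.card_univ, ← Finset.card_erase_add_one (Finset.mem_univ v)] at hv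
  have h : ({w | G.Adj v w} : Finset V) = Finset.univ.erase v :=
    Finset.eq_of_subset_of_card_le (fun x hx => by simpa using (Finset.mem_filter.1 hx).2.ne')
      (by omega)
  have hw : w ∈ Finset.univ.erase v := Finset.mem_erase.2 ⟨hvw.symm, Finset.mem_univ w⟩
  exact (Finset.mem_filter.1 (h ▸ hw)).2

open Classical in
theorem card_add_card_adj_le_deg {v : V} (hv : ∀ a ∈ A, G.Adj v a) :
    #A + #{w | w ∉ A ∧ G.Adj v w} ≤ deg G v := by
  rw [deg_eq_card, ← Finset.card_union_of_disjoint]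
  · exact Finset.card_le_card fun w => by simp; grind
  · exact Finset.disjoint_left.2 fun w hw => by simp [hw]

open Classical in
/-- Four of the vertices of a copy of `completeMinus U f` lie outside `A`, where `G` has maximum
degree one up to the exception at `p`, so they span at most two edges. -/
theorem not_completeMinus_isContained [Fintype L] (p : V) {U : SimpleGraph K} {f : K ↪ L}
    (hA : ∀ v ∈ A, deg G v + 1 = Fintype.card V)
    (hG : ∀ v ∉ A, deg G v ≤ #A + if v = p then 2 else 1) (hL : #A + 4 ≤ Fintype.card L)
    (hC4 : ¬ SimpleGraph.cycleGraph 4 ⊑ U) (hZ4 : ¬ Z4 ⊑ U) : ¬ completeMinus U f ⊑ G := by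
  rintro ⟨φ⟩
  have degree_outside : ∀ v ∉ A, #{w | w ∉ A ∧ G.Adj v w} ≤ if v = p then 2 else 1 :=
    fun v hv => by
      have := card_add_card_adj_le_deg fun a ha =>
        (adj_of_deg_add_one_eq_card (hA a ha) (ne_of_mem_of_not_mem ha hv)).symm
      have := hG v hv
      omega
  obtain ⟨Q, hQ, hQ4⟩ := Finset.exists_subset_card_eq (s := {x | φ x ∉ A}) (n := 4) (by
    have h1 : #{x | φ x ∈ A} ≤ #A :=
      Finset.card_le_card_of_injOn φ (fun x hx => by simpa using hx) φ.injective.injOn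
    have h2 := Finset.card_filter_add_card_filter_not (s := Finset.univ) fun x => φ x ∈ A
    rw [Finset.card_univ] at h2
    omega)
  have hQA : ∀ x : Q, φ x ∉ A := fun x => (Finset.mem_filter.1 (hQ x.2)).2
  have hinj : Function.Injective fun x : Q => φ x := φ.injective.comp Subtype.val_injective
  let H : SimpleGraph Q := G.comap fun x => φ x
  have hHU : Hᶜ ⊑ U.map f := by
    refine ⟨⟨⟨Subtype.val, fun {x y} hxy => ?_⟩, Subtype.val_injective⟩⟩
    by_contra h
    exact hxy.2 (φ.toHom.map_adj ⟨Subtype.val_injective.ne hxy.1, h⟩)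
  have hdeg : ∀ x, deg H x ≤ 1 + if φ x = p then 1 else 0 := fun x => by
    have h : deg H x ≤ #{w | w ∉ A ∧ G.Adj (φ x) w} := by
      rw [deg_eq_card]
      refine Finset.card_le_card_of_injOn _ (fun y hy => ?_) hinj.injOn
      simpa [hQA, H] using hy
    have := h.trans (degree_outside _ (hQA x))
    split_ifs at this ⊢ <;> omega
  have hp : #{x : Q | φ x = p} ≤ 1 :=
    Finset.card_le_one.2 fun x hx y hy => hinj (by simp_all)
  have hsum := Finset.sum_le_sum fun x (_ : x ∈ Finset.univ) => hdeg x
  rw [sum_deg, Finset.sum_add_distrib, ← Finset.card_filter, Finset.sum_const, Finset.card_univ,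
    Fintype.card_coe, hQ4, smul_eq_mul] at hsum
  have := two_lt_ncard_edgeSet_of_compl_isContained_map (by rw [Fintype.card_coe, hQ4]) hHU hC4 hZ4
  omega

end Obstruction

section ExtremalSequence

theorem IsDegreeFunction.add_universal {V : Type*} [Fintype V] [DecidableEq V] {b : V → ℕ}
    {A : Finset V} (h : IsDegreeFunction b) (hA : ∀ v ∈ A, b v = 0) :
    IsDegreeFunction fun v => if v ∈ A then Fintype.card V - 1 else #A + b v := by
  classical
  obtain ⟨B, hB⟩ := h
  let J : SimpleGraph V := (⊤ : SimpleGraph V).between A Set.univ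
  have hJ : ∀ v w, J.Adj v w ↔ v ≠ w ∧ (v ∈ A ∨ w ∈ A) := fun v w => by
    simp [J, SimpleGraph.between_adj]
  have isolated : ∀ v ∈ A, ∀ w, ¬ B.Adj v w := fun v hv =>
    deg_eq_zero_iff.1 ((hB v).trans (hA v hv))
  have hJB : Disjoint J B := SimpleGraph.disjoint_left.2 fun v w hvw hB => by
    rcases ((hJ v w).1 hvw).2 with hv | hw
    exacts [isolated v hv w hB, isolated w hw v hB.symm]
  refine ⟨J ⊔ B, fun v => ?_⟩
  rw [deg_sup hJB, hB]
  dsimp only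
  split_ifs with hv
  · rw [hA v hv, add_zero, deg_eq_card, ← Finset.card_univ,
      ← Finset.card_erase_of_mem (Finset.mem_univ v)]
    congr 1
    ext w
    simp [hJ, hv, eq_comm]
  · rw [deg_eq_card]
    congr 2
    ext w
    simp only [hJ, hv, false_or, Finset.mem_filter_univ, and_iff_right_iff_imp]
    rintro hw rfl
    exact hv hw

variable {n m : ℕ}

theorem sum_ite_lt_add_ite_eq (hm : m < n) (x y z : ℕ) :
    ∑ i : Fin n, (if i.val < m then x else y + if i.val = m then z else 0) =
      m * x + (n - m) * y + z := by
  obtain ⟨t, rfl⟩ := Nat.exists_eq_add_of_lt hm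
  rw [Fin.sum_univ_eq_sum_range (fun i => if i < m then x else y + if i = m then z else 0),
    add_assoc, Finset.sum_range_add, Finset.sum_range_succ',
    Finset.sum_congr rfl fun i hi => if_pos (Finset.mem_range.1 hi)]
  simp
  ring

/-- The degree sequence of the join of a complete graph on `m` vertices with a graph on `n - m`
vertices which is a perfect matching or, if `n - m` is odd, the disjoint union of a matching and a
path with two edges. -/
def extremalSequence (n m : ℕ) (i : Fin n) : ℕ :=
  if i.val < m then n - 1 else m + (1 + if i.val = m then (n - m) % 2 else 0)

theorem antitone_extremalSequence (hm : m + 3 ≤ n) : Antitone (extremalSequence n m) := by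
  intro i j hij
  have : i.val ≤ j.val := hij
  grind [extremalSequence]

theorem isDegreeFunction_extremalSequence (hm : m + 3 ≤ n) :
    IsDegreeFunction (extremalSequence n m) := by
  let b : Fin n → ℕ := fun i => if i.val < m then 0 else 1 + if i.val = m then (n - m) % 2 else 0
  have hb : AlmostFlat 2 b := by
    refine ⟨fun i => by grind, ?_⟩
    have : #(firstVertices n m)ᶜ = n - m := by
      rw [Finset.card_compl, card_firstVertices (by omega), Fintype.card_fin]
    refine (show 2 + 1 ≤ #(firstVertices n m)ᶜ by omega).trans (Finset.card_le_card fun i hi => ?_)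
    simp only [Finset.mem_compl, mem_firstVertices] at hi
    simp only [Finset.mem_filter_univ, b, if_neg hi]
    omega
  have hsum : Even (∑ i, b i) := by
    rw [sum_ite_lt_add_ite_eq (by omega), Nat.even_iff]
    omega
  convert (hb.isDegreeFunction hsum).add_universal (A := firstVertices n m) (fun v hv => by
    simp [b, mem_firstVertices.1 hv]) using 2 with i
  grind [extremalSequence, mem_firstVertices, card_firstVertices, Fintype.card_fin]

theorem isGraphic_extremalSequence (hm : m + 3 ≤ n) : IsGraphic (extremalSequence n m) :=
  ⟨antitone_extremalSequence hm, isDegreeFunction_extremalSequence hm⟩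

theorem not_potentiallyGraphic_extremalSequence {K L : Type*} [Fintype L] {U : SimpleGraph K}
    {f : K ↪ L} (hm : m < n) (hL : m + 4 ≤ Fintype.card L)
    (hC4 : ¬ SimpleGraph.cycleGraph 4 ⊑ U) (hZ4 : ¬ Z4 ⊑ U) :
    ¬ PotentiallyGraphic (completeMinus U f) (extremalSequence n m) := by
  rintro ⟨G, hG, hc⟩
  have hdeg : ∀ i, deg G i = extremalSequence n m i := hG
  have hcard := card_firstVertices hm.le
  refine not_completeMinus_isContained (A := firstVertices n m) ⟨m, hm⟩ (fun i hi => ?_)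
    (fun i hi => ?_) (by omega) hC4 hZ4 hc
  · rw [hdeg, extremalSequence, if_pos (mem_firstVertices.1 hi), Fintype.card_fin]
    omega
  · rw [mem_firstVertices] at hi
    simp only [hdeg, extremalSequence, if_neg hi, hcard, Fin.ext_iff]
    split_ifs <;> omega

theorem sum_extremalSequence_add_two {r : ℕ} (hr : 3 ≤ r) (hn : r ≤ n) :
    ((∑ i, extremalSequence n (r - 3) i + 2 : ℕ) : ℤ) =
      if Odd ((n : ℤ) - r) then ((r : ℤ) - 1) * (2 * n - r) - 3 * (n - r) - 1
      else ((r : ℤ) - 1) * (2 * n - r) - 3 * (n - r) := by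
  obtain ⟨m, rfl⟩ := Nat.exists_eq_add_of_le' hr
  obtain ⟨t, rfl⟩ := Nat.exists_eq_add_of_le' hn
  have hsum : ∑ i, extremalSequence (t + (m + 3)) m i =
      m * (t + m + 2) + (t + 3) * (m + 1) + (t + 3) % 2 := by
    have h := sum_ite_lt_add_ite_eq (show m < t + (m + 3) by omega) (t + m + 2) (m + 1)
      ((t + 3) % 2)
    rw [show t + (m + 3) - m = t + 3 by omega] at h
    rw [← h]
    refine Finset.sum_congr rfl fun i _ => ?_
    rw [extremalSequence, show t + (m + 3) - m = t + 3 by omega, add_assoc m 1]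
    rfl
  rw [Nat.add_sub_cancel, hsum]
  split_ifs with h <;> rw [Int.odd_iff] at h
  · rw [show (t + 3) % 2 = 0 by omega]
    push_cast
    ring
  · rw [show (t + 3) % 2 = 1 by omega]
    push_cast
    ring

end ExtremalSequence

section Sigma

theorem potentiallyGraphic_of_le_sum {n r : ℕ} {K : Type*} {U : SimpleGraph K} {d : Fin n → ℕ}
    (hr : 2 ≤ r) (hn : 5 * r + 18 ≤ n) (hn' : r + 42 ≤ n) (hU : K3unionP3 ⊑ U)
    (f : K ↪ Fin (r + 1)) (hd : IsGraphic d)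
    (hsum : (2 * (r : ℤ) - 5) * n - r ^ 2 + 4 * r ≤ (∑ i, d i : ℕ) + 1) :
    PotentiallyGraphic (completeMinus U f) d := by
  obtain ⟨-, G, hG⟩ := hd
  obtain rfl : deg G = d := funext hG
  obtain ⟨G', hG', T, hT, p, hp⟩ :=
    hasNearClique_of_le_sum_deg hr G (by simpa) (by simpa) (by simpa using hsum)
  exact ⟨G', hG', completeMinus_isContained hU f (by simpa using hT) hp⟩

theorem isLeast_sigmaSet {V : Type*} {n : ℕ} {H : SimpleGraph V} {d : Fin n → ℕ}
    (hd : IsGraphic d) (hdH : ¬ PotentiallyGraphic H d)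
    (hH : ∀ d' : Fin n → ℕ, IsGraphic d' → ∑ i, d i + 2 ≤ ∑ i, d' i → PotentiallyGraphic H d') :
    IsLeast (sigmaSet H n) (∑ i, d i + 2) := by
  have heven : Even (∑ i, d i) := by
    obtain ⟨-, G, hG⟩ := hd
    obtain rfl : deg G = d := funext hG
    exact even_sum_deg G
  refine ⟨⟨heven.add even_two, hH⟩, fun l ⟨hl, hlH⟩ => ?_⟩
  by_contra! hlt
  refine hdH (hlH d hd ?_)
  rw [Nat.even_iff] at heven hl
  omega

end Sigma

theorem theorem1p2 (n r k j : ℕ) (hn : 5 * r + 18 ≤ n) (hkr : k ≤ r + 1) (hk : 7 ≤ k)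
    (hj : 6 ≤ j) (U : SimpleGraph (Fin k)) (hUj : U.edgeSet.ncard = j)
    (hU : K3unionP3 ⊑ U) (hC4 : ¬ SimpleGraph.cycleGraph 4 ⊑ U) (hZ4 : ¬ Z4 ⊑ U)
    (f : Fin k ↪ Fin (r + 1)) :
    IsLeast (sigmaSet (completeMinus U f) n) (sigma (completeMinus U f) n) ∧
      (sigma (completeMinus U f) n : ℤ) =
        if Odd ((n : ℤ) - r) then ((r : ℤ) - 1) * (2 * n - r) - 3 * (n - r) - 1
        else ((r : ℤ) - 1) * (2 * n - r) - 3 * (n - r) := by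
  have hvalue := sum_extremalSequence_add_two (n := n) (r := r) (by omega) (by omega)
  have hleast : IsLeast (sigmaSet (completeMinus U f) n)
      (∑ i, extremalSequence n (r - 3) i + 2) := by
    refine isLeast_sigmaSet (isGraphic_extremalSequence (by omega))
      (not_potentiallyGraphic_extremalSequence (by omega) (by rw [Fintype.card_fin]; omega) hC4 hZ4)
      fun d hd hle => potentiallyGraphic_of_le_sum (by omega) hn (by omega) hU f hd ?_
    have hle' : ((∑ i, extremalSequence n (r - 3) i + 2 : ℕ) : ℤ) ≤ (∑ i, d i : ℕ) :=
      Nat.cast_le.2 hle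
    rw [hvalue] at hle'
    split_ifs at hle' <;> linarith
  have hsigma : sigma (completeMinus U f) n = ∑ i, extremalSequence n (r - 3) i + 2 :=
    hleast.csInf_eq
  rw [hsigma]
  exact ⟨hleast, hvalue⟩
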